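/- A *measure* on $\mathbb{R}$ is a complex Radon measure, viewed as a linear functional $\mu$ on $C_{\mathsf c}(\mathbb{R})$ such that for every compact $K$ there is a constant $C_K$ with $|\mu(g)|\le C_K\|g\|_\infty$ for all $g$ supported in $K$; $|\mu|$ denotes its total variation. For $x\in\mathbb{R}$ and a measure $\mu$, the measure $\delta_x*\mu$ is given by $(\delta_x*\mu)(g)=\mu\bigl(g(\cdot+x)\bigr)$, and $\bigl(\sum_m c_m\delta_{x_m}\bigr)*\mu=\sum_m c_m(\delta_{x_m}*\mu)$ for finite sums. Further, $\delta_{\alpha\mathbb{Z}}=\sum_{k\in\mathbb{Z}}\delta_{\alpha k}$. For functions, $\widehat g(y)=\int_{\mathbb{R}}\mathrm{e}^{-2\pi\mathrm{i}xy}g(x)\,\mathrm{d}x$ and $\check g(y)=\widehat g(-y)$. A measure $\mu$ is *tempered* if its restriction to $C_{\mathsf c}^\infty(\mathbb{R})$ extends to a tempered distribution. A measure $\mu\neq0$ is an *eigenmeasure* of the Fourier transform $\mathcal{F}$ with eigenvalue $\lambda$ if it is tempered and the Fourier transform of this tempered distribution (defined by $\widehat T(\varphi)=T(\widehat\varphi)$)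 is the distribution defined by the measure $\lambda\mu$. A measure $\mu$ is *strictly transformable* with transform $\nu$, where $\nu$ is a measure, if for all $f,g\in C_{\mathsf c}(\mathbb{R})$ the function $(f*g)\check{\ }$ lies in $L^1(|\nu|)$ and $\mu(f*g)=\int_{\mathbb{R}}(f*g)\check{\ }\,\mathrm{d}\nu$. A tempered measure $\mu\ne0$ is a *strict eigenmeasure* of $\mathcal{F}$ with eigenvalue $\lambda$ if it is strictly transformable with transform $\lambda\mu$. Finally, $U_n=\bigl(n^{-1/2}\,\mathrm{e}^{-2\pi\mathrm{i}\,jk/n}\bigr)_{0\le j,k\le n-1}$ is the unitary DFT matrix. **Theorem.** Let $\alpha>0$, let $\lambda\in\mathbb{C}$ with $\lambda^4=1$, and let $\mu\neq0$ be a measure on $\mathbb{R}$ that is $\alpha$-periodic, that is, $\delta_\alpha*\mu=\mu$. Then the following properties are equivalent. 1. $\mu$ is an eigenmeasure of $\mathcal{F}$ with eigenvalue $\lambda$. 2. $\mu$ is a strict eigenmeasure of $\mathcal{F}$ with eigenvalue $\lambda$. 3. There are an integer $n\ge1$ with $\alpha=\sqrt n$ and a vector $c=(c_0,\dots,c_{n-1})^T\in\mathbb{C}^n$,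 $c\neq0$, with $U_nc=\lambda c$ such that $$\mu=\Bigl(\sum_{m=0}^{n-1}c_m\,\delta_{m/\alpha}\Bigr)*\delta_{\alpha\mathbb{Z}} .$$ -/

import Mathlib

open MeasureTheory
open scoped CompactlySupported FourierTransform SchwartzMap Convolution

noncomputable section

namespace Eigenmeasure

/-- The complex vector space of (complex, generally unbounded) Radon measures on `ℝ`, viewed as
linear functionals on `C_c(ℝ, ℂ)` that are continuous for the inductive limit topology: for every
compact `K` there is a constant `C` with `‖μ g‖ ≤ C * ‖g‖_∞` for all `g` supported in `K`. -/
def RadonMeasure : Submodule ℂ (C_c(ℝ, ℂ) →ₗ[ℂ] ℂ) where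
  carrier := {μ | ∀ K : Set ℝ, IsCompact K → ∃ C : ℝ, ∀ g : C_c(ℝ, ℂ), tsupport g ⊆ K →
    ∀ M : ℝ, (∀ x, ‖g x‖ ≤ M) → ‖μ g‖ ≤ C * M}
  add_mem' := by
    intro μ ν hμ hν K hK
    obtain ⟨C, hC⟩ := hμ K hK
    obtain ⟨D, hD⟩ := hν K hK
    refine ⟨C + D, fun g hg M hM => ?_⟩
    have h := norm_add_le (μ g) (ν g)
    have h1 := hC g hg M hM
    have h2 := hD g hg M hM
    simp only [LinearMap.add_apply]
    linarith
  zero_mem' := by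
    intro K _
    exact ⟨0, fun g _ M _ => by simp⟩
  smul_mem' := by
    intro a μ hμ K hK
    obtain ⟨C, hC⟩ := hμ K hK
    refine ⟨‖a‖ * C, fun g hg M hM => ?_⟩
    simp only [LinearMap.smul_apply, norm_smul]
    have h := mul_le_mul_of_nonneg_left (hC g hg M hM) (norm_nonneg a)
    linarith

/-! ### Translates, lattice Dirac combs and periodicity -/

/-- The function `y ↦ g (y + t)`. -/
def shift (t : ℝ) (g : C_c(ℝ, ℂ)) : C_c(ℝ, ℂ) :=
  g.comp (Homeomorph.addRight t).toCocompactMap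

theorem shift_apply (t : ℝ) (g : C_c(ℝ, ℂ)) (y : ℝ) : shift t g y = g (y + t) := rfl

/-- The convolution `δ_t * μ` of a point mass with a Radon measure, that is,
`(δ_t * μ)(g) = ∫∫ g (x + y) dδ_t(x) dμ(y) = ∫ g (t + y) dμ(y)`. -/
def diracConv (t : ℝ) (μ : RadonMeasure) : RadonMeasure where
  val :=
    { toFun := fun g => μ.1 (shift t g)
      map_add' := fun f g => μ.1.map_add (shift t f) (shift t g)
      map_smul' := fun a g => μ.1.map_smul a (shift t g) }
  property := by
    intro K hK
    obtain ⟨C, hC⟩ := μ.2 ((fun y => y + -t) '' K) (hK.image (by fun_prop))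
    refine ⟨C, fun g hg M hM => hC (shift t g) ?_ M fun x => hM (x + t)⟩
    refine closure_minimal (fun y hy => ?_) (hK.image (by fun_prop)).isClosed
    exact ⟨y + t, hg (subset_tsupport _ hy), by simp⟩

/-- `μ` is `α`-periodic: `δ_α * μ = μ`. -/
def IsPeriodic (α : ℝ) (μ : RadonMeasure) : Prop :=
  diracConv α μ = μ

theorem finite_lattice_support {α : ℝ} (hα : 0 < α) {K : Set ℝ} (hK : IsCompact K) :
    {k : ℤ | α * k ∈ K}.Finite := by
  obtain ⟨R, hR⟩ := hK.isBounded.exists_norm_le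
  refine (Set.finite_Icc ⌊-(R / α)⌋ ⌈R / α⌉).subset fun k hk => ?_
  have h1 := abs_le.1 (hR _ hk)
  have h2 : (k : ℝ) ≤ R / α := by rw [le_div_iff₀ hα]; linarith
  have h3 : -(R / α) ≤ (k : ℝ) := by
    rw [neg_le, ← neg_le_neg_iff, neg_neg, neg_le, le_div_iff₀ hα]; linarith
  exact ⟨Int.cast_le.1 ((Int.floor_le _).trans h3), Int.cast_le.1 (h2.trans (Int.le_ceil _))⟩

theorem support_lattice_subset (α : ℝ) (g : C_c(ℝ, ℂ)) :
    (Function.support fun k : ℤ => g (α * k)) ⊆ {k : ℤ | α * k ∈ tsupport g} :=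
  fun _ hk => subset_tsupport _ hk

theorem summable_lattice {α : ℝ} (hα : 0 < α) (g : C_c(ℝ, ℂ)) :
    Summable fun k : ℤ => g (α * k) :=
  summable_of_hasFiniteSupport
    ((finite_lattice_support hα g.hasCompactSupport).subset (support_lattice_subset α g))

/-- The lattice Dirac comb `δ_{αℤ} = ∑_{k ∈ ℤ} δ_{αk}`, for `α > 0`; evaluated at a compactly
supported function, the sum has only finitely many non-zero terms. -/
def latticeComb (α : ℝ) (hα : 0 < α) : RadonMeasure where
  val :=
    { toFun := fun g => ∑' k : ℤ, g (α * k)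
      map_add' := fun f g => (summable_lattice hα f).tsum_add (summable_lattice hα g)
      map_smul' := fun a g => (summable_lattice hα g).tsum_const_smul a }
  property := by
    intro K hK
    have hfin := finite_lattice_support hα hK
    refine ⟨hfin.toFinset.card, fun g hg M hM => ?_⟩
    have h : ∑' k : ℤ, g (α * k) = ∑ k ∈ hfin.toFinset, g (α * k) := by
      refine tsum_eq_sum fun k hk => ?_
      by_contra h0
      exact hk (hfin.mem_toFinset.2 (hg (support_lattice_subset α g h0)))
    change ‖∑' k : ℤ, g (α * k)‖ ≤ _
    rw [h]
    refine (norm_sum_le_of_le (f := fun k : ℤ => g (α * k)) (n := fun _ => M) _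
      fun k _ => hM (α * k)).trans ?_
    simp

/-! ### Fourier transform of tempered measures -/

/-- The tempered distribution `T` and the Radon measure `μ` define the same distribution: they
agree on all smooth functions of compact support. -/
def Represents (T : 𝓢'(ℝ, ℂ)) (μ : RadonMeasure) : Prop :=
  ∀ (φ : 𝓢(ℝ, ℂ)) (hφ : HasCompactSupport φ), T φ = μ.1 ⟨⟨φ, φ.continuous⟩, hφ⟩

/-- `μ` is tempered: the distribution defined by `μ` is a tempered distribution. -/
def IsTempered (μ : RadonMeasure) : Prop :=
  ∃ T : 𝓢'(ℝ, ℂ), Represents T μ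

/-- `μ` is tempered and transformable, and its distributional Fourier transform is the
measure `ν`. -/
def HasFourierTransform (μ ν : RadonMeasure) : Prop :=
  ∃ T : 𝓢'(ℝ, ℂ), Represents T μ ∧ Represents (𝓕 T) ν

/-- `μ` is an eigenmeasure of the Fourier transform with eigenvalue `l`. -/
def IsEigenmeasure (l : ℂ) (μ : RadonMeasure) : Prop :=
  μ ≠ 0 ∧ HasFourierTransform μ (l • μ)

/-! ### Fourier transform of measures in the strict sense -/

/-- The polar decomposition `ν = h · m` of a complex Radon measure: `m` is a positive Radon measure
and `h` is a measurable unimodular function. Every `ν` has such a decomposition; `m` is the total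
variation `|ν|`, and `h` is unique up to `|ν|`-null sets. -/
structure IsPolarDecomposition (ν : RadonMeasure) (m : Measure ℝ) (h : ℝ → ℂ) : Prop where
  locallyFinite : IsLocallyFiniteMeasure m
  measurable : Measurable h
  norm_eq_one : ∀ x, ‖h x‖ = 1
  apply_eq : ∀ g : C_c(ℝ, ℂ), ν.1 g = ∫ x, g x * h x ∂m

/-- The convolution `f * g` of two continuous functions of compact support. -/
def conv (f g : C_c(ℝ, ℂ)) : C_c(ℝ, ℂ) where
  toFun := (f : ℝ → ℂ) ⋆[ContinuousLinearMap.mul ℝ ℂ, volume] (g : ℝ → ℂ)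
  continuous_toFun := HasCompactSupport.continuous_convolution_right _ g.hasCompactSupport
    (Continuous.locallyIntegrable f.continuous) g.continuous
  hasCompactSupport' := HasCompactSupport.convolution _ f.hasCompactSupport g.hasCompactSupport

theorem conv_apply (f g : C_c(ℝ, ℂ)) (x : ℝ) : conv f g x = ∫ t, f t * g (x - t) := rfl

/-- `μ` is transformable in the strict sense (as a measure on the locally compact Abelian group
`ℝ`) with transform `ν`: for every `k = f * g` with `f, g ∈ C_c(ℝ, ℂ)`, and hence for every `k` in
their linear span `K₂(ℝ)`, the inverse Fourier transform of `k` lies in `L¹(|ν|)`, and its integral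
with respect to `ν` is `μ(k)`. -/
def HasStrictFourierTransform (μ ν : RadonMeasure) : Prop :=
  ∃ (m : Measure ℝ) (h : ℝ → ℂ), IsPolarDecomposition ν m h ∧
    ∀ f g : C_c(ℝ, ℂ), Integrable (𝓕⁻ (conv f g : ℝ → ℂ)) m ∧
      μ.1 (conv f g) = ∫ y, 𝓕⁻ (conv f g : ℝ → ℂ) y * h y ∂m

/-- `μ` is a strict eigenmeasure of the Fourier transform with eigenvalue `l`: a non-trivial
tempered measure that is transformable in the strict sense, with strict transform `l • μ`. -/
def IsStrictEigenmeasure (l : ℂ) (μ : RadonMeasure) : Prop :=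
  μ ≠ 0 ∧ IsTempered μ ∧ HasStrictFourierTransform μ (l • μ)

/-! ### The discrete Fourier transform -/

/-- The unitary DFT matrix `U_n`, with entries `n^{-1/2} exp(-2πi j k / n)`, `0 ≤ j, k < n`. -/
def dftMatrix (n : ℕ) : Matrix (Fin n) (Fin n) ℂ :=
  Matrix.of fun j k =>
    (1 / (Real.sqrt n : ℂ)) *
      Complex.exp (-2 * Real.pi * Complex.I * ((j : ℕ) : ℂ) * ((k : ℕ) : ℂ) / (n : ℂ))

end Eigenmeasure

end

noncomputable section

open Filter Topology

namespace Eigenmeasure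

/-! The Fourier transform turns `α`-periodicity of `μ` into the identity `(exp(2πiαx) - 1) · λμ =
0`. As `λ ≠ 0`, the measure `μ` itself is annihilated by `charSubOne α`, hence carried by the zero
set `ℤ/α`. Being a measure, it involves no derivatives of point masses there, so it is a sum of
weighted Dirac masses (`apply_eq_tsum`). Periodicity, used again, gives `exp(2πiα²) = 1` because `μ
≠ 0`; so `α² = n` is an integer, and the weights on `ℤ/√n` are `n`-periodic
(`exists_eq_sum_diracConv`).

For such combs everything reduces to linear algebra. Poisson summation over the cosets of `√n ℤ` in
`ℤ/√n` says that the vector of coset sums of `f` is `U_n` applied to that of `𝓕⁻ f`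
(`cosetSums_eq_mulVec`). Since `U_n` is symmetric, the comb with vector `c` has as transform the
comb with vector `U_n c`, and test functions concentrated near one lattice point recover the vector.
Thus the eigenvalue equation for `μ` is `U_n c = λc`.

The strict case has the same skeleton. Summability of `𝓕⁻ (f * g)` over the lattice comes from
Bessel's inequality. The annihilation is obtained from uniqueness of Fourier transforms of finite
measures, followed by removal of the factor `𝓕⁻ (f * g)` by a limit
(`apply_mulLeft_charSubOne_of_strict`). -/

/-- The sum of `f` over the translate `αℤ + t` of the lattice `αℤ`. -/
def latticeSum (α t : ℝ) (f : ℝ → ℂ) : ℂ := ∑' k : ℤ, f (α * k + t)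

/-- The vector of the sums of `f` over the cosets `αℤ + m/α`, `0 ≤ m < n`. -/
def cosetSums (α : ℝ) (n : ℕ) (f : ℝ → ℂ) : Fin n → ℂ := fun m => latticeSum α ((m : ℕ) / α) f

/-- The `n`-periodic sequence on `ℤ` with period `c`. -/
def periodicExt (n : ℕ) [NeZero n] (c : Fin n → ℂ) (j : ℤ) : ℂ := c (Int.divModEquiv n j).2

/-! ### Splitting sums over `ℤ/√n` into cosets of `√n ℤ` -/

section Cosets

variable {n : ℕ} [NeZero n]

theorem sqrt_natCast_pos : 0 < √(n : ℝ) :=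
  Real.sqrt_pos.2 (Nat.cast_pos.2 (Nat.pos_of_ne_zero (NeZero.ne n)))

theorem divModEquiv_symm_div_sqrt (k : ℤ) (m : Fin n) :
    (((Int.divModEquiv n).symm (k, m) : ℤ) : ℝ) / √(n : ℝ) =
      √(n : ℝ) * k + ((m : ℕ) : ℝ) / √(n : ℝ) := by
  have h := sqrt_natCast_pos (n := n)
  have h2 : √(n : ℝ) * √(n : ℝ) = n := Real.mul_self_sqrt (Nat.cast_nonneg n)
  simp only [Int.divModEquiv, Equiv.coe_fn_symm_mk]
  push_cast
  field_simp
  rw [sq, h2]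

/-- Division with remainder `j = kn + m` gives `j/√n = √n k + m/√n`, and the weight depends on `m`
only. Absolute summability permits the regrouping. -/
theorem tsum_periodicExt_mul {c : Fin n → ℂ} {F : ℝ → ℂ}
    (hF : Summable fun j : ℤ => F (j / √(n : ℝ))) :
    ∑' j : ℤ, periodicExt n c j * F (j / √(n : ℝ)) = c ⬝ᵥ cosetSums (√n) n F := by
  have hb : Summable fun j : ℤ => periodicExt n c j * F (j / √(n : ℝ)) := by
    refine Summable.of_norm_bounded (g := fun j : ℤ => (∑ m, ‖c m‖) * ‖F (j / √(n : ℝ))‖)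
      (hF.norm.mul_left _) fun j => ?_
    rw [norm_mul]
    gcongr
    exact Finset.single_le_sum (f := fun m => ‖c m‖) (fun i _ => norm_nonneg _)
      (Finset.mem_univ _)
  have hb' := (Int.divModEquiv n).symm.summable_iff.2 hb
  rw [← (Int.divModEquiv n).symm.tsum_eq, ← (Equiv.prodComm _ _).tsum_eq]
  refine (Summable.tsum_prod ((Equiv.prodComm _ _).summable_iff.2 hb')).trans ?_
  rw [tsum_fintype]
  refine Finset.sum_congr rfl fun m _ => ?_
  simp only [Function.comp_apply, Equiv.prodComm_apply, Prod.swap_prod_mk, periodicExt,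
    Equiv.apply_symm_apply, divModEquiv_symm_div_sqrt, tsum_mul_left]
  rfl

end Cosets

/-! ### Poisson summation and the DFT matrix -/

section Poisson

theorem fourier_comp_mul_left (f : ℝ → ℂ) {a : ℝ} (ha : 0 < a) (y : ℝ) :
    𝓕 (fun x => f (a * x)) y = (a : ℂ)⁻¹ * 𝓕 f (y / a) := by
  simp only [Real.fourier_real_eq_integral_exp_smul]
  have := Measure.integral_comp_mul_left
    (fun x => Complex.exp (↑(-2 * Real.pi * x * (y / a)) * Complex.I) • f x) a
  rw [abs_of_pos (inv_pos.2 ha)] at this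
  rw [← Complex.ofReal_inv, ← Complex.real_smul, ← this]
  refine integral_congr_ae (.of_forall fun x => ?_)
  simp only
  congr 4
  field_simp

theorem fourierInv_comp_mul_left (f : ℝ → ℂ) {a : ℝ} (ha : 0 < a) (y : ℝ) :
    𝓕⁻ (fun x => f (a * x)) y = (a : ℂ)⁻¹ * 𝓕⁻ f (y / a) := by
  rw [Real.fourierInv_eq_fourier_neg, Real.fourierInv_eq_fourier_neg, fourier_comp_mul_left f ha,
    neg_div]

theorem fourierInv_comp_add_right (f : ℝ → ℂ) (t y : ℝ) :
    𝓕⁻ (fun x => f (x + t)) y = Complex.exp (↑(-2 * Real.pi * t * y) * Complex.I) * 𝓕⁻ f y := by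
  rw [Real.fourierInv_eq_fourier_neg, Real.fourierInv_eq_fourier_neg]
  simp only [Real.fourier_real_eq_integral_exp_smul]
  rw [← integral_const_mul]
  refine Eq.trans ?_ (integral_add_right_eq_self _ t)
  refine integral_congr_ae (.of_forall fun x => ?_)
  simp only [smul_eq_mul]
  rw [← mul_assoc, ← Complex.exp_add]
  congr 2
  push_cast
  ring

theorem continuous_fourierInv {f : ℝ → ℂ} (hf : Integrable f) : Continuous (𝓕⁻ f) := by
  have h : 𝓕⁻ f = fun y => 𝓕 f (-y) := funext fun y => Real.fourierInv_eq_fourier_neg f y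
  rw [h]
  exact (VectorFourier.fourierIntegral_continuous Real.continuous_fourierChar
    (by simpa using! continuous_inner) hf).comp continuous_neg

variable {n : ℕ} [NeZero n]

/-- Poisson's summation formula over the cosets of `√n ℤ` in `ℤ/√n`. -/
theorem cosetSums_eq_mulVec {f : ℝ → ℂ} (hc : Continuous f)
    (hf : f =O[cocompact ℝ] fun x : ℝ => |x| ^ (-2 : ℝ))
    (hs : Summable fun j : ℤ => 𝓕⁻ f (j / √(n : ℝ))) :
    cosetSums (√n) n f = (dftMatrix n).mulVec (cosetSums (√n) n (𝓕⁻ f)) := by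
  have hα := sqrt_natCast_pos (n := n)
  have hα2 : √(n : ℝ) * √(n : ℝ) = n := Real.mul_self_sqrt (Nat.cast_nonneg n)
  have hn0 : (n : ℂ) ≠ 0 := Nat.cast_ne_zero.2 (NeZero.ne n)
  set α : ℝ := √(n : ℝ) with hαdef
  have hFf : ∀ y, 𝓕 (fun x => f (α * x)) y = (α : ℂ)⁻¹ * 𝓕⁻ f (-y / α) := fun y => by
    rw [fourier_comp_mul_left f hα, Real.fourierInv_eq_fourier_neg, neg_div, neg_neg]
  have hO : (fun x => f (α * x)) =O[cocompact ℝ] fun x : ℝ => |x| ^ (-2 : ℝ) := by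
    have h1 := hf.comp_tendsto (Homeomorph.mulLeft₀ α hα.ne').isClosedEmbedding.tendsto_cocompact
    refine h1.trans (Asymptotics.IsBigO.of_bound (|α| ^ (-2 : ℝ)) (.of_forall fun x => ?_))
    simp only [Function.comp_apply, Homeomorph.coe_mulLeft₀, abs_mul]
    rw [Real.mul_rpow (abs_nonneg _) (abs_nonneg _), norm_mul]
    gcongr
    rw [Real.norm_of_nonneg (by positivity)]
  have hs' : Summable fun j : ℤ => 𝓕 (fun x => f (α * x)) j := by
    simp_rw [hFf]
    refine Summable.mul_left _ ?_
    have := (Equiv.neg ℤ).summable_iff.2 hs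
    refine this.congr fun j => ?_
    simp
  funext m
  -- Rescaling by `α` turns the lattice `αℤ` into `ℤ` and the coset representative `m/α` into `m/α²
  -- = m/n`.
  have key := Real.tsum_eq_tsum_fourier_of_rpow_decay_of_summable (hc.comp (continuous_const_mul α))
    one_lt_two hO hs' ((m : ℕ) / n)
  have hl : cosetSums α n f m = ∑' k : ℤ, (f ∘ fun x => α * x) ((m : ℕ) / n + k) := by
    refine tsum_congr fun k => ?_
    simp only [Function.comp_apply]
    congr 1
    rw [← hα2]
    field_simp
    ring
  rw [hl, key, ← (Equiv.neg ℤ).tsum_eq]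
  have hterm : ∀ j : ℤ, 𝓕 (f ∘ fun x => α * x) ((Equiv.neg ℤ j : ℤ) : ℝ) *
      fourier (Equiv.neg ℤ j) (((m : ℕ) / n : ℝ) : UnitAddCircle) =
      periodicExt n (fun r => dftMatrix n m r) j * 𝓕⁻ f (j / α) := by
    intro j
    have h1 : 𝓕 (f ∘ fun x => α * x) ((Equiv.neg ℤ j : ℤ) : ℝ) = (α : ℂ)⁻¹ * 𝓕⁻ f (j / α) := by
      have := hFf ((Equiv.neg ℤ j : ℤ) : ℝ)
      simpa [Function.comp_def] using this
    rw [h1, mul_right_comm]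
    congr 1
    obtain ⟨⟨k, r⟩, rfl⟩ := (Int.divModEquiv n).symm.surjective j
    simp only [periodicExt, Equiv.apply_symm_apply, dftMatrix, Matrix.of_apply, one_div]
    congr 1
    rw [fourier_coe_apply, Complex.exp_eq_exp_iff_exists_int]
    -- For `j = kn + r`, the phases `-jm/n` and `-rm/n` differ by the integer `-km`.
    refine ⟨-(k * m), ?_⟩
    simp only [Equiv.neg_apply, Int.divModEquiv, Equiv.coe_fn_symm_mk]
    push_cast
    field_simp
    ring
  rw [tsum_congr hterm, tsum_periodicExt_mul hs]
  rfl

end Poisson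

/-! ### Density of test functions in the Schwartz space -/

section Density

open scoped ContDiff

/-- `1 - s` vanishes for `|x| < 1` and has bounded derivatives. The bound is linear in `|x|` so that
replacing `x` by `εx` produces a factor `ε`. -/
theorem exists_norm_iteratedFDeriv_le_mul_abs :
    ∃ s : ℝ → ℂ, ContDiff ℝ ∞ s ∧ HasCompactSupport s ∧ ∀ i : ℕ, ∃ C, 0 ≤ C ∧ ∀ x,
      ‖iteratedFDeriv ℝ i (fun y => 1 - s y) x‖ ≤ C * |x| := by
  let χ : ContDiffBump (0 : ℝ) := ⟨1, 2, one_pos, one_lt_two⟩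
  let s : ℝ → ℂ := Complex.ofRealCLM ∘ χ
  have hs : ContDiff ℝ ∞ s := Complex.ofRealCLM.contDiff.comp χ.contDiff
  have hc : HasCompactSupport s := χ.hasCompactSupport.comp_left rfl
  refine ⟨s, hs, hc, fun i => ?_⟩
  obtain ⟨C, hC⟩ := (hs.continuous_iteratedFDeriv (m := i) (mod_cast le_top)).norm
    |>.bounded_above_of_compact_support (hc.iteratedFDeriv i).norm
  have hC0 : 0 ≤ C := (norm_nonneg _).trans (hC 0)
  refine ⟨C + 1, by positivity, fun x => ?_⟩
  by_cases hx : |x| < 1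
  · have h : (fun y => 1 - s y) =ᶠ[𝓝 x] fun _ => 0 := by
      filter_upwards [(isOpen_lt continuous_abs continuous_const).mem_nhds hx] with y hy
      have : χ y = 1 := χ.one_of_mem_closedBall (by simpa using le_of_lt hy)
      simp [s, this]
    rw [(h.iteratedFDeriv ℝ i).eq_of_nhds]
    simpa using by positivity
  · have h1 : iteratedFDeriv ℝ i (fun y => 1 - s y) x =
        iteratedFDeriv ℝ i (fun _ => (1 : ℂ)) x - iteratedFDeriv ℝ i s x :=
      fun_iteratedFDeriv_sub_apply contDiff_const.contDiffAt
        (hs.of_le (mod_cast le_top)).contDiffAt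
    have h2 : ‖iteratedFDeriv ℝ i (fun _ : ℝ => (1 : ℂ)) x‖ ≤ 1 := by
      rcases i with _ | i
      · simp
      · simp [iteratedFDeriv_succ_const]
    have h3 : ‖iteratedFDeriv ℝ i s x‖ ≤ C := by simpa using hC x
    rw [h1]
    calc _ ≤ 1 + C := (norm_sub_le _ _).trans (add_le_add h2 h3)
      _ ≤ (C + 1) * |x| := by nlinarith [not_lt.1 hx]

/-- Smooth functions of compact support are dense in the Schwartz space. -/
theorem dense_hasCompactSupport : Dense {f : 𝓢(ℝ, ℂ) | HasCompactSupport f} := by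
  intro f
  obtain ⟨s, hs, hc, hC⟩ := exists_norm_iteratedFDeriv_le_mul_abs
  choose C hC0 hC using hC
  let ε : ℕ → ℝ := fun j => 1 / ((j : ℝ) + 1)
  have hε0 : ∀ j, 0 < ε j := fun j => by positivity
  have hε1 : ∀ j, ε j ≤ 1 := fun j => by
    rw [div_le_one (by positivity)]
    linarith [Nat.cast_nonneg (α := ℝ) j]
  have hε : Tendsto ε atTop (𝓝 0) := tendsto_one_div_add_atTop_nhds_zero_nat
  have hsε : ∀ j, ContDiff ℝ ∞ fun x => s (ε j * x) := fun j => hs.comp (by fun_prop)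
  have hcε : ∀ j, HasCompactSupport fun x => s (ε j * x) := fun j =>
    hc.comp_homeomorph (Homeomorph.mulLeft₀ (ε j) (hε0 j).ne')
  have hfs : ContDiff ℝ ∞ f := f.smooth ⊤
  have hcf : ∀ j, HasCompactSupport fun x => s (ε j * x) * f x := fun j => (hcε j).mul_right
  let F : ℕ → 𝓢(ℝ, ℂ) := fun j => (hcf j).toSchwartzMap ((hsε j).mul hfs)
  refine mem_closure_of_tendsto (f := F) (b := atTop) ?_ (.of_forall hcf)
  rw [(schwartz_withSeminorms ℝ ℝ ℂ).tendsto_nhds]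
  rintro ⟨k, n⟩ δ hδ
  -- Leibniz' rule: the factor `ε|x|` from the cut-off raises the weight `|x| ^ k` to `|x| ^ (k +
  -- 1)`, which a higher seminorm of `f` absorbs.
  let B : ℝ := ∑ i ∈ Finset.range (n + 1), n.choose i * C i * SchwartzMap.seminorm ℝ (k + 1) (n - i) f
  have hB : 0 ≤ B := Finset.sum_nonneg fun i _ => by
    have := hC0 i
    positivity
  have hle : ∀ j, SchwartzMap.seminorm ℝ k n (F j - f) ≤ ε j * B := by
    intro j
    refine SchwartzMap.seminorm_le_bound ℝ k n _ (mul_nonneg (hε0 j).le hB) fun x => ?_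
    have hfun : (⇑(F j - f) : ℝ → ℂ) = -fun x => (1 - s (ε j * x)) * f x := by
      funext x
      change s (ε j * x) * f x - f x = -((1 - s (ε j * x)) * f x)
      ring
    have hρ : ContDiff ℝ ∞ fun y => 1 - s y := contDiff_const.sub hs
    have hD : ∀ i, ‖iteratedFDeriv ℝ i (fun y => 1 - s (ε j * y)) x‖ ≤ C i * (ε j * |x|) := by
      intro i
      have := congrFun (iteratedFDeriv_comp_const_smul (i := i) (ε j)
        (hρ.of_le (mod_cast le_top))) x
      simp only [smul_eq_mul] at this
      rw [this, norm_smul, norm_pow, Real.norm_of_nonneg (hε0 j).le]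
      refine (mul_le_of_le_one_left (norm_nonneg _) (pow_le_one₀ (hε0 j).le (hε1 j))).trans ?_
      refine (hC i _).trans (le_of_eq ?_)
      rw [abs_mul, abs_of_pos (hε0 j)]
    rw [hfun, iteratedFDeriv_neg_apply, norm_neg]
    have hL := norm_iteratedFDeriv_mul_le (n := n) (N := ∞)
      (f := fun x => 1 - s (ε j * x)) (contDiff_const.sub (hsε j)) hfs x
      (mod_cast le_top)
    calc _ ≤ ‖x‖ ^ k * _ := mul_le_mul_of_nonneg_left hL (by positivity)
      _ ≤ _ := by
        rw [Finset.mul_sum, Finset.mul_sum]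
        refine Finset.sum_le_sum fun i _ => ?_
        calc _ ≤ ‖x‖ ^ k * (n.choose i * (C i * (ε j * |x|)) *
              ‖iteratedFDeriv ℝ (n - i) f x‖) := by
              gcongr
              exact hD i
          _ = ε j * (n.choose i * C i * (‖x‖ ^ (k + 1) * ‖iteratedFDeriv ℝ (n - i) f x‖)) := by
              rw [Real.norm_eq_abs]
              ring
          _ ≤ _ := by
              have := hC0 i
              have := (hε0 j).le
              gcongr
              exact SchwartzMap.le_seminorm ℝ _ _ f x
  have hlim : Tendsto (fun j => ε j * B) atTop (𝓝 0) := by simpa using hε.mul_const B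
  filter_upwards [hlim.eventually_lt_const hδ] with j hj
  exact (hle j).trans_lt hj

/-- Tempered distributions are determined by their values at smooth functions of compact support. -/
theorem temperedDistribution_ext {S T : 𝓢'(ℝ, ℂ)}
    (h : ∀ φ : 𝓢(ℝ, ℂ), HasCompactSupport φ → S φ = T φ) (f : 𝓢(ℝ, ℂ)) : S f = T f := by
  exact congrFun (Continuous.ext_on dense_hasCompactSupport (map_continuous S)
    (map_continuous T) fun φ hφ => h φ hφ) f

end Density

/-! ### Lattice sums as tempered distributions -/

section LatticeDistribution

variable {α : ℝ}

theorem summable_one_add_abs_lattice (hα : 0 < α) (t : ℝ) :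
    Summable fun k : ℤ => ((1 + |α * k + t|) ^ 2)⁻¹ := by
  have hO : (fun k : ℤ => ((1 + |α * k + t|) ^ 2)⁻¹) =O[cofinite]
      fun k : ℤ => |(k : ℝ)| ^ (-2 : ℝ) := by
    refine Asymptotics.IsBigO.of_bound (((1 + |t|) / α) ^ 2) ?_
    filter_upwards [(Set.finite_singleton (0 : ℤ)).compl_mem_cofinite] with k hk
    have hk0 : (k : ℝ) ≠ 0 := Int.cast_ne_zero.2 hk
    have hk1 : 0 < |(k : ℝ)| := abs_pos.2 hk0
    have h1 : α * |(k : ℝ)| ≤ (1 + |t|) * (1 + |α * k + t|) := by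
      have : α * |(k : ℝ)| ≤ |α * k + t| + |t| := by
        calc α * |(k : ℝ)| = |(α * k + t) - t| := by
              rw [add_sub_cancel_right, abs_mul, abs_of_pos hα]
          _ ≤ _ := abs_sub _ _
      nlinarith [abs_nonneg t, abs_nonneg (α * k + t)]
    rw [Real.norm_of_nonneg (by positivity), Real.norm_of_nonneg (by positivity),
      Real.rpow_neg hk1.le, Real.rpow_two, ← inv_pow, ← inv_pow, ← mul_pow]
    gcongr
    rw [div_mul_eq_mul_div, le_div_iff₀ hα, inv_mul_le_iff₀ (by positivity), ← mul_assoc,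
      ← div_eq_mul_inv, le_div_iff₀ hk1]
    linarith
  exact summable_of_isBigO (Real.summable_abs_int_rpow one_lt_two) hO

theorem norm_apply_lattice_le (f : 𝓢(ℝ, ℂ)) (x : ℝ) :
    ‖f x‖ ≤ (2 ^ 2 * (Finset.Iic ((2, 0) : ℕ × ℕ)).sup (schwartzSeminormFamily ℂ ℝ ℂ) f) *
      ((1 + |x|) ^ 2)⁻¹ := by
  rw [← div_eq_mul_inv, le_div_iff₀' (by positivity)]
  simpa [schwartzSeminormFamily] using! SchwartzMap.one_add_le_sup_seminorm_apply (𝕜 := ℂ) (m := (2, 0)) (k := 2) (n := 0)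
    le_rfl le_rfl f x

theorem summable_schwartz_lattice (hα : 0 < α) (t : ℝ) (f : 𝓢(ℝ, ℂ)) :
    Summable fun k : ℤ => f (α * k + t) :=
  Summable.of_norm_bounded ((summable_one_add_abs_lattice hα t).mul_left _)
    fun _ => norm_apply_lattice_le f _

/-- The tempered distribution `φ ↦ ∑ k, φ (α * k + t)`. -/
def latticeDistribution (hα : 0 < α) (t : ℝ) : 𝓢'(ℝ, ℂ) :=
  ContinuousLinearMap.toPointwiseConvergenceCLM _ _ _ _ <|
    SchwartzMap.mkCLMtoNormedSpace (𝕜 := ℂ) (σ := RingHom.id ℂ)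
      (fun f : 𝓢(ℝ, ℂ) => latticeSum α t f)
      (fun f g => (summable_schwartz_lattice hα t f).tsum_add (summable_schwartz_lattice hα t g))
      (fun a f => (summable_schwartz_lattice hα t f).tsum_const_smul a)
      ⟨Finset.Iic (2, 0), 2 ^ 2 * ∑' k : ℤ, ((1 + |α * k + t|) ^ 2)⁻¹,
        mul_nonneg (by positivity) (tsum_nonneg fun _ => by positivity), fun f => by
          have h := (summable_one_add_abs_lattice hα t).mul_left
            (2 ^ 2 * (Finset.Iic ((2, 0) : ℕ × ℕ)).sup (schwartzSeminormFamily ℂ ℝ ℂ) f)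
          refine (tsum_of_norm_bounded h.hasSum fun k => norm_apply_lattice_le f _).trans
            (le_of_eq ?_)
          rw [tsum_mul_left]
          ring⟩

end LatticeDistribution

/-! ### Measures annihilated by a continuous function -/

/-- The product of a continuous function with a continuous function of compact support. -/
def mulLeft (u : C(ℝ, ℂ)) (g : C_c(ℝ, ℂ)) : C_c(ℝ, ℂ) where
  toFun x := u x * g x
  continuous_toFun := u.continuous.mul g.continuous
  hasCompactSupport' := g.hasCompactSupport.mul_left

theorem mulLeft_apply (u : C(ℝ, ℂ)) (g : C_c(ℝ, ℂ)) (x : ℝ) : mulLeft u g x = u x * g x := rfl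

/-- A Schwartz function of compact support, as an element of `C_c(ℝ, ℂ)`. -/
def ofSchwartz (φ : 𝓢(ℝ, ℂ)) (hφ : HasCompactSupport φ) : C_c(ℝ, ℂ) := ⟨⟨φ, φ.continuous⟩, hφ⟩

theorem ofSchwartz_apply (φ : 𝓢(ℝ, ℂ)) (hφ : HasCompactSupport φ) (x : ℝ) :
    ofSchwartz φ hφ x = φ x := rfl

/-- The function `x ↦ exp(2πiαx) - 1`, with zeros `ℤ/α`. -/
def charSubOne (α : ℝ) : C(ℝ, ℂ) :=
  ⟨fun x => Complex.exp (2 * Real.pi * Complex.I * (α * x)) - 1, by fun_prop⟩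

theorem charSubOne_apply (α x : ℝ) :
    charSubOne α x = Complex.exp (2 * Real.pi * Complex.I * (α * x)) - 1 := rfl

theorem norm_charSubOne_le (α x : ℝ) : ‖charSubOne α x‖ ≤ 2 := by
  rw [charSubOne_apply]
  refine (norm_sub_le _ _).trans ?_
  have : (2 * Real.pi * Complex.I * (α * x) : ℂ) = ((2 * Real.pi * (α * x) : ℝ) : ℂ) * Complex.I := by
    push_cast
    ring
  rw [this, Complex.norm_exp_ofReal_mul_I, norm_one]
  norm_num

theorem exists_int_of_charSubOne_eq_zero {α x : ℝ} (h : charSubOne α x = 0) :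
    ∃ j : ℤ, α * x = j := by
  obtain ⟨j, hj⟩ := Complex.exp_eq_one_iff.1 (sub_eq_zero.1 h)
  refine ⟨j, ?_⟩
  have h2 : (2 * Real.pi * Complex.I : ℂ) ≠ 0 := Complex.two_pi_I_ne_zero
  have : (α * x : ℂ) = j := mul_left_cancel₀ h2 (by rw [hj]; ring)
  exact_mod_cast this

section Support

variable {μ : RadonMeasure}

/-- All approximants share the compact set `K`, so a single constant controls `μ` on every
difference `g - w`. -/
theorem apply_eq_zero_of_approx {K : Set ℝ} (hK : IsCompact K) {g : C_c(ℝ, ℂ)}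
    (hg : tsupport g ⊆ K)
    (h : ∀ ε > 0, ∃ w : C_c(ℝ, ℂ), tsupport w ⊆ K ∧ μ.1 w = 0 ∧ ∀ x, ‖g x - w x‖ ≤ ε) :
    μ.1 g = 0 := by
  obtain ⟨C, hC⟩ := μ.2 K hK
  have hle : ∀ ε > 0, ‖μ.1 g‖ ≤ |C| * ε := by
    intro ε hε
    obtain ⟨w, hw, hw0, hgw⟩ := h ε hε
    have h1 := hC (g - w) ((tsupport_sub (g : ℝ → ℂ) w).trans (Set.union_subset hg hw)) ε hgw
    rw [map_sub, hw0, sub_zero] at h1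
    exact h1.trans (mul_le_mul_of_nonneg_right (le_abs_self C) hε.le)
  rw [← norm_le_zero_iff]
  refine le_of_forall_pos_le_add fun δ hδ => ?_
  refine (hle (δ / (|C| + 1)) (by positivity)).trans ?_
  rw [zero_add, mul_div_assoc', div_le_iff₀ (by positivity)]
  nlinarith [abs_nonneg C]

theorem apply_mulLeft_eq_zero_of_schwartz {u : C(ℝ, ℂ)} {M : ℝ} (hu : ∀ x, ‖u x‖ ≤ M)
    (h : ∀ (φ : 𝓢(ℝ, ℂ)) (hφ : HasCompactSupport φ), μ.1 (mulLeft u (ofSchwartz φ hφ)) = 0)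
    (g : C_c(ℝ, ℂ)) : μ.1 (mulLeft u g) = 0 := by
  have hM : 0 ≤ M := (norm_nonneg _).trans (hu 0)
  obtain ⟨R, hR0, hR⟩ := g.hasCompactSupport.isBounded.exists_pos_norm_le
  -- The cut-off equals `1` on the support of `g`, so `χ g'` stays as close to `g` as the smooth
  -- approximant `g'` does, with support in a set independent of `ε`.
  let χ : ContDiffBump (0 : ℝ) := ⟨R, R + 1, hR0, by linarith⟩
  have hχg : ∀ x, (χ x : ℂ) * g x = g x := by
    intro x
    by_cases hx : x ∈ tsupport g
    · rw [χ.one_of_mem_closedBall (by simpa using hR x hx), Complex.ofReal_one, one_mul]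
    · rw [image_eq_zero_of_notMem_tsupport hx, mul_zero]
  refine apply_eq_zero_of_approx (K := tsupport g ∪ tsupport χ)
    (g.hasCompactSupport.union χ.hasCompactSupport) ?_ fun ε hε => ?_
  · exact (tsupport_mul_subset_right (f := u) (g := g)).trans Set.subset_union_left
  have huc : UniformContinuous g := g.continuous.uniformContinuous_of_tendsto_cocompact
    (x := 0) g.hasCompactSupport.is_zero_at_infty
  obtain ⟨g', hg', hgg'⟩ := huc.exists_contDiff_dist_le (ε := ε / (M + 1)) (by positivity)
  have hcχ : HasCompactSupport (fun x => (χ x : ℂ)) := 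
    χ.hasCompactSupport.comp_left (g := Complex.ofReal) Complex.ofReal_zero
  have hsχ : ContDiff ℝ (⊤ : ℕ∞) (fun x => (χ x : ℂ)) := Complex.ofRealCLM.contDiff.comp χ.contDiff
  have hc : HasCompactSupport (fun x => (χ x : ℂ) * g' x) := hcχ.mul_right
  refine ⟨mulLeft u (ofSchwartz (hc.toSchwartzMap (hsχ.mul hg')) hc), ?_, h _ _, fun x => ?_⟩
  · refine (tsupport_mul_subset_right (f := u) (g := fun x => (χ x : ℂ) * g' x)).trans ?_
    refine (tsupport_mul_subset_left (f := fun x => (χ x : ℂ)) (g := g')).trans ?_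
    refine Set.subset_union_of_subset_right (closure_mono fun x hx => ?_) _
    simpa using hx
  · have h1 : mulLeft u g x - mulLeft u (ofSchwartz (hc.toSchwartzMap (hsχ.mul hg')) hc) x =
        u x * ((χ x : ℂ) * (g x - g' x)) := by
      rw [mul_sub, hχg, mul_sub]
      rfl
    rw [h1, norm_mul, norm_mul, Complex.norm_real, Real.norm_of_nonneg χ.nonneg]
    have h2 : ‖g x - g' x‖ ≤ ε / (M + 1) := by
      rw [← dist_eq_norm, dist_comm]
      exact (hgg' x).le
    calc _ ≤ M * (1 * (ε / (M + 1))) := by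
          have := χ.le_one (x := x)
          have := χ.nonneg (x := x)
          gcongr
          exact hu x
      _ ≤ ε := by
          rw [one_mul, mul_div_assoc', div_le_iff₀ (by positivity)]
          nlinarith

/-- Regularised division by `u`: for `v = ū/(|u|² + η)` the product `u v g` is killed by `μ` and
differs from `g` by `g η/(|u|² + η)`. This is small where `|g| < ε`; on the compact set `|g| ≥ ε`,
`u` has no zero and so is bounded below. -/
theorem apply_eq_zero_of_vanishes {u : C(ℝ, ℂ)} (h : ∀ g : C_c(ℝ, ℂ), μ.1 (mulLeft u g) = 0)
    {g : C_c(ℝ, ℂ)} (hg : ∀ x, u x = 0 → g x = 0) : μ.1 g = 0 := by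
  refine apply_eq_zero_of_approx g.hasCompactSupport subset_rfl fun ε hε => ?_
  obtain ⟨M, hM⟩ := g.continuous.bounded_above_of_compact_support g.hasCompactSupport
  have hM0 : 0 ≤ M := (norm_nonneg _).trans (hM 0)
  have hS : IsCompact (tsupport g ∩ {x | ε ≤ ‖g x‖}) :=
    g.hasCompactSupport.isCompact.inter_right (isClosed_le continuous_const g.continuous.norm)
  obtain ⟨m, hm0, hm⟩ := hS.exists_forall_le' (f := fun x => ‖u x‖ ^ 2) (a := 0)
    (by fun_prop) fun x hx => by
      have : u x ≠ 0 := fun h0 => by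
        have := hx.2
        simp only [Set.mem_ofPred_eq, hg x h0, norm_zero] at this
        linarith
      positivity
  -- Chosen so that `M η / m ≤ ε`.
  let η : ℝ := ε * m / (M + 1)
  have hη : 0 < η := by positivity
  have hden : ∀ x, ((‖u x‖ ^ 2 + η : ℝ) : ℂ) ≠ 0 := fun x =>
    Complex.ofReal_ne_zero.2 (by positivity)
  let v : C(ℝ, ℂ) := ⟨fun x => (starRingEnd ℂ) (u x) / ((‖u x‖ ^ 2 + η : ℝ) : ℂ),
    Continuous.div (by fun_prop) (by fun_prop) hden⟩
  refine ⟨mulLeft u (mulLeft v g), ?_, h _, fun x => ?_⟩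
  · exact (tsupport_mul_subset_right (f := u) (g := mulLeft v g)).trans
      (tsupport_mul_subset_right (f := v) (g := g))
  have h1 : g x - mulLeft u (mulLeft v g) x = g x * ((η / (‖u x‖ ^ 2 + η) : ℝ) : ℂ) := by
    have h2 : u x * (starRingEnd ℂ) (u x) = ((‖u x‖ ^ 2 : ℝ) : ℂ) := by
      rw [Complex.mul_conj, Complex.normSq_eq_norm_sq]
    have h3 : mulLeft u (mulLeft v g) x =
        (u x * (starRingEnd ℂ) (u x)) / ((‖u x‖ ^ 2 + η : ℝ) : ℂ) * g x := by
      simp only [mulLeft_apply, v, ContinuousMap.coe_mk]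
      ring
    have h4 := hden x
    rw [h3, h2, Complex.ofReal_div]
    field_simp
    push_cast
    ring
  rw [h1, norm_mul, Complex.norm_real, Real.norm_of_nonneg (by positivity)]
  by_cases hx : ε ≤ ‖g x‖
  · have hxt : x ∈ tsupport g := subset_tsupport _ fun h0 => by
      rw [h0, norm_zero] at hx
      linarith
    have hmx := hm x ⟨hxt, hx⟩
    calc _ ≤ M * (η / m) := by
          gcongr
          · exact hM x
          · linarith
      _ = M * ε / (M + 1) := by
          simp only [η]
          field_simp
      _ ≤ ε := by
          rw [div_le_iff₀ (by positivity)]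
          nlinarith
  · refine (mul_le_of_le_one_right (norm_nonneg _) ?_).trans (not_le.1 hx).le
    rw [div_le_one (by positivity)]
    nlinarith [sq_nonneg ‖u x‖]

end Support

/-- A bump function in `C_c(ℝ, ℂ)` at `0` of radius `r`. -/
def bump (r : ℝ) (hr : 0 < r) : C_c(ℝ, ℂ) :=
  let χ : ContDiffBump (0 : ℝ) := ⟨r / 2, r, half_pos hr, half_lt_self hr⟩
  ⟨⟨fun x => (χ x : ℂ), Complex.continuous_ofReal.comp χ.continuous⟩,
    χ.hasCompactSupport.comp_left (g := Complex.ofReal) Complex.ofReal_zero⟩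

section Structure

variable {α : ℝ} {μ : RadonMeasure}

theorem IsPeriodic.apply_shift (h : IsPeriodic α μ) (g : C_c(ℝ, ℂ)) : μ.1 (shift α g) = μ.1 g :=
  congrArg (fun ν : RadonMeasure => ν.1 g) h

theorem exists_apply_ne_zero (hμ : μ ≠ 0) : ∃ g, μ.1 g ≠ 0 := by
  by_contra! h
  exact hμ (Subtype.ext (LinearMap.ext h))

/-- With `u = charSubOne α`, one has `u(x + α) = u(x) + u(α)(u(x) + 1)`. Applying the periodic `μ`
to `u g` shifted by `α` leaves `u(α) μ(g) = 0`, whence `α² ∈ ℤ`. -/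
theorem exists_eq_sqrt (hα : 0 < α) (hμ : μ ≠ 0) (hper : IsPeriodic α μ)
    (h : ∀ g : C_c(ℝ, ℂ), μ.1 (mulLeft (charSubOne α) g) = 0) :
    ∃ n : ℕ, 0 < n ∧ α = √(n : ℝ) := by
  obtain ⟨g, hg⟩ := exists_apply_ne_zero hμ
  have h1 : shift α (mulLeft (charSubOne α) g) = mulLeft (charSubOne α) (shift α g) +
      charSubOne α α • (mulLeft (charSubOne α) (shift α g) + shift α g) := by
    ext x
    have : (2 * Real.pi * Complex.I * (α * (x + α : ℝ)) : ℂ) =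
      2 * Real.pi * Complex.I * (α * x) + 2 * Real.pi * Complex.I * (α * α) := by
      push_cast
      ring
    simp only [CompactlySupportedContinuousMap.coe_add, CompactlySupportedContinuousMap.coe_smul,
      Pi.add_apply, Pi.smul_apply, smul_eq_mul, shift_apply, mulLeft_apply, charSubOne_apply, this,
      Complex.exp_add]
    ring
  have h2 := hper.apply_shift (mulLeft (charSubOne α) g)
  rw [h1, h, map_add, map_smul, map_add, h, hper.apply_shift, zero_add, zero_add, smul_eq_mul,
    mul_eq_zero, or_iff_left hg] at h2
  obtain ⟨j, hj⟩ := exists_int_of_charSubOne_eq_zero h2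
  have hj0 : 0 < j := by
    have : (0 : ℝ) < j := hj ▸ mul_pos hα hα
    exact_mod_cast this
  refine ⟨j.toNat, by omega, ?_⟩
  have h3 : ((j.toNat : ℕ) : ℝ) = j := by
    exact_mod_cast congrArg (Int.cast (R := ℝ)) (Int.toNat_of_nonneg hj0.le)
  rw [h3, ← hj, Real.sqrt_mul_self hα.le]

theorem bump_zero {r : ℝ} (hr : 0 < r) : bump r hr 0 = 1 := by
  let χ : ContDiffBump (0 : ℝ) := ⟨r / 2, r, half_pos hr, half_lt_self hr⟩
  change ((χ 0 : ℝ) : ℂ) = 1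
  rw [χ.one_of_mem_closedBall (by simpa [χ] using (half_pos hr).le), Complex.ofReal_one]

theorem bump_eq_zero {r : ℝ} (hr : 0 < r) {x : ℝ} (hx : r ≤ |x|) : bump r hr x = 0 := by
  let χ : ContDiffBump (0 : ℝ) := ⟨r / 2, r, half_pos hr, half_lt_self hr⟩
  change ((χ x : ℝ) : ℂ) = 0
  rw [χ.zero_of_le_dist (by simpa [χ] using hx), Complex.ofReal_zero]

/-- Bumps of radius `1/α` around the points `j/α` vanish at all other points of `ℤ/α`, so they
interpolate `g` there. The interpolation error vanishes on the zero set of `charSubOne α` and is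
invisible to `μ`. -/
theorem apply_eq_tsum (hα : 0 < α) (h : ∀ g : C_c(ℝ, ℂ), μ.1 (mulLeft (charSubOne α) g) = 0)
    (g : C_c(ℝ, ℂ)) :
    μ.1 g = ∑' j : ℤ, μ.1 (shift (-(j / α)) (bump α⁻¹ (inv_pos.2 hα))) * g (j / α) := by
  have hfin := finite_lattice_support (inv_pos.2 hα) g.hasCompactSupport
  set B := bump α⁻¹ (inv_pos.2 hα)
  have hJ : ∀ j : ℤ, j ∉ hfin.toFinset → g (j / α) = 0 := fun j hj => by
    rw [Set.Finite.mem_toFinset, Set.mem_ofPred_eq, inv_mul_eq_div] at hj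
    exact image_eq_zero_of_notMem_tsupport hj
  rw [tsum_eq_sum (s := hfin.toFinset) fun j hj => by rw [hJ j hj, mul_zero]]
  have h0 : μ.1 (g - ∑ j ∈ hfin.toFinset, g (j / α) • shift (-(j / α)) B) = 0 := by
    refine apply_eq_zero_of_vanishes h fun x hx => ?_
    obtain ⟨i, hi⟩ := exists_int_of_charSubOne_eq_zero hx
    obtain rfl : x = i / α := by rw [← hi, mul_div_cancel_left₀ _ hα.ne']
    have hB : ∀ j : ℤ, j ≠ i → B (i / α + -(j / α)) = 0 := fun j hj => by
      refine bump_eq_zero _ ?_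
      rw [← sub_eq_add_neg, ← sub_div, abs_div, abs_of_pos hα, inv_eq_one_div]
      gcongr
      have : (1 : ℤ) ≤ |i - j| := Int.one_le_abs (sub_ne_zero.2 hj.symm)
      exact_mod_cast this
    have hsum : (∑ j ∈ hfin.toFinset, g (j / α) • shift (-(j / α)) B) (i / α) =
        ∑ j ∈ hfin.toFinset, g (j / α) * B (i / α + -(j / α)) := by
      rw [CompactlySupportedContinuousMap.coe_sum, Finset.sum_apply]
      rfl
    rw [CompactlySupportedContinuousMap.coe_sub, Pi.sub_apply, hsum,
      Finset.sum_eq_single i (fun j _ hj => by rw [hB j hj, mul_zero])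
        (fun hi => by rw [hJ i hi, zero_mul]), add_neg_cancel, bump_zero, mul_one, sub_self]
  rw [map_sub, sub_eq_zero] at h0
  rw [h0, map_sum]
  exact Finset.sum_congr rfl fun j _ => by rw [map_smul, smul_eq_mul, mul_comm]

theorem sum_smul_diracConv_apply (hα : 0 < α) {n : ℕ} (c : Fin n → ℂ) (g : C_c(ℝ, ℂ)) :
    (∑ m : Fin n, c m • diracConv ((m : ℕ) / α) (latticeComb α hα)).1 g =
      c ⬝ᵥ cosetSums α n g := by
  rw [Submodule.coe_sum, LinearMap.sum_apply]
  rfl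

theorem summable_compactlySupported_lattice (hα : 0 < α) (g : C_c(ℝ, ℂ)) :
    Summable fun j : ℤ => g (j / α) := by
  simpa only [inv_mul_eq_div] using summable_lattice (inv_pos.2 hα) g

/-- An `α`-periodic measure that is annihilated by `exp(2πiαx) - 1` is a lattice Dirac comb. -/
theorem exists_eq_sum_diracConv (hα : 0 < α) (hμ : μ ≠ 0) (hper : IsPeriodic α μ)
    (h : ∀ (φ : 𝓢(ℝ, ℂ)) (hφ : HasCompactSupport φ),
      μ.1 (mulLeft (charSubOne α) (ofSchwartz φ hφ)) = 0) :
    ∃ n : ℕ, 0 < n ∧ α = √(n : ℝ) ∧ ∃ c : Fin n → ℂ, c ≠ 0 ∧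
      μ = ∑ m : Fin n, c m • diracConv ((m : ℕ) / α) (latticeComb α hα) := by
  have h' := apply_mulLeft_eq_zero_of_schwartz (norm_charSubOne_le α) h
  obtain ⟨n, hn, hαn⟩ := exists_eq_sqrt hα hμ hper h'
  have : NeZero n := ⟨hn.ne'⟩
  have hα2 : α * α = n := by rw [hαn, Real.mul_self_sqrt (Nat.cast_nonneg n)]
  let a : ℤ → ℂ := fun j => μ.1 (shift (-(j / α)) (bump α⁻¹ (inv_pos.2 hα)))
  -- Since `n/α = α`, moving from `j` to `j + n` translates the bump by exactly one period of `μ`.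
  have ha : Function.Periodic a n := by
    intro j
    simp only [a]
    rw [← hper.apply_shift]
    congr 1
    ext x
    simp only [shift_apply]
    congr 1
    push_cast
    rw [← hα2]
    field_simp
    ring
  have hμc : μ = ∑ m : Fin n, a (m : ℕ) • diracConv ((m : ℕ) / α) (latticeComb α hα) := by
    refine Subtype.ext (LinearMap.ext fun g => ?_)
    have hper' : ∀ j, a j = periodicExt n (fun m => a (m : ℕ)) j := by
      intro j
      obtain ⟨⟨k, m⟩, rfl⟩ := (Int.divModEquiv n).symm.surjective j
      simp only [periodicExt, Equiv.apply_symm_apply]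
      change a (k * n + (m : ℕ)) = _
      rw [add_comm]
      exact ha.int_mul k _
    rw [sum_smul_diracConv_apply hα (fun m : Fin n => a (m : ℕ)), apply_eq_tsum hα h']
    change ∑' j : ℤ, a j * g (j / α) = _
    rw [tsum_congr fun j : ℤ => congrArg (· * g (j / α)) (hper' j)]
    clear_value a
    subst hαn
    exact tsum_periodicExt_mul (summable_compactlySupported_lattice hα g)
  refine ⟨n, hn, hαn, fun m => a (m : ℕ), fun h0 => hμ ?_, hμc⟩
  rw [hμc]
  exact Finset.sum_eq_zero fun m _ => by rw [show a (m : ℕ) = 0 from congrFun h0 m, zero_smul]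

end Structure

theorem transpose_dftMatrix (n : ℕ) : (dftMatrix n).transpose = dftMatrix n := by
  ext j k
  simp only [Matrix.transpose_apply, dftMatrix, Matrix.of_apply]
  congr 3
  ring

theorem dotProduct_dftMatrix_mulVec {n : ℕ} (c v : Fin n → ℂ) :
    c ⬝ᵥ (dftMatrix n).mulVec v = (dftMatrix n).mulVec c ⬝ᵥ v := by
  rw [Matrix.dotProduct_mulVec, ← Matrix.mulVec_transpose, transpose_dftMatrix]

/-! ### Fourier transforms of lattice combs -/

section Distribution

variable {n : ℕ} [NeZero n]

theorem cosetSums_eq_single {f : ℝ → ℂ} (m : Fin n)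
    (hf : ∀ x, (√(n : ℝ))⁻¹ ≤ |x - (m : ℕ) / √(n : ℝ)| → f x = 0) :
    cosetSums (√n) n f = Pi.single m (f ((m : ℕ) / √(n : ℝ))) := by
  have hα := sqrt_natCast_pos (n := n)
  have key : ∀ (k : ℤ) (r : Fin n), (k, r) ≠ (0, m) → f (√(n : ℝ) * k + (r : ℕ) / √(n : ℝ)) = 0 := by
    intro k r hkr
    refine hf _ ?_
    have hne : (Int.divModEquiv n).symm (k, r) ≠ (Int.divModEquiv n).symm (0, m) :=
      (Int.divModEquiv n).symm.injective.ne hkr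
    have h0 := divModEquiv_symm_div_sqrt (n := n) 0 m
    rw [Int.cast_zero, mul_zero, zero_add] at h0
    rw [← divModEquiv_symm_div_sqrt, ← h0, ← sub_div, abs_div, abs_of_pos hα, inv_eq_one_div]
    gcongr
    exact_mod_cast Int.one_le_abs (sub_ne_zero.2 hne)
  funext r
  change ∑' k : ℤ, f (√(n : ℝ) * k + (r : ℕ) / √(n : ℝ)) = _
  rw [tsum_eq_single 0 fun k hk => key k r fun h => hk (Prod.ext_iff.1 h).1, Int.cast_zero, mul_zero,
    zero_add]
  by_cases hr : r = m
  · subst hr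
    rw [Pi.single_eq_same]
  · rw [Pi.single_eq_of_ne hr]
    simpa using key 0 r fun h => hr (Prod.ext_iff.1 h).2

theorem exists_schwartz_cosetSums_eq_single (m : Fin n) :
    ∃ φ : 𝓢(ℝ, ℂ), HasCompactSupport φ ∧ cosetSums (√n) n φ = Pi.single m 1 := by
  have hα := sqrt_natCast_pos (n := n)
  let χ : ContDiffBump ((m : ℕ) / √(n : ℝ)) :=
    ⟨(√(n : ℝ))⁻¹ / 2, (√(n : ℝ))⁻¹, half_pos (inv_pos.2 hα), half_lt_self (inv_pos.2 hα)⟩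
  have hc : HasCompactSupport (fun x => (χ x : ℂ)) :=
    χ.hasCompactSupport.comp_left (g := Complex.ofReal) Complex.ofReal_zero
  have hs : ContDiff ℝ (⊤ : ℕ∞) (fun x => (χ x : ℂ)) := Complex.ofRealCLM.contDiff.comp χ.contDiff
  refine ⟨hc.toSchwartzMap hs, hc, ?_⟩
  have h1 : (hc.toSchwartzMap hs) ((m : ℕ) / √(n : ℝ)) = 1 := by
    change ((χ _ : ℝ) : ℂ) = 1
    rw [χ.one_of_mem_closedBall (Metric.mem_closedBall_self χ.rIn_pos.le), Complex.ofReal_one]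
  rw [cosetSums_eq_single m fun x hx => ?_, h1]
  change ((χ x : ℝ) : ℂ) = 0
  rw [χ.zero_of_le_dist (by simpa [χ, Real.dist_eq] using hx), Complex.ofReal_zero]

theorem summable_schwartz_div_sqrt (f : 𝓢(ℝ, ℂ)) : Summable fun j : ℤ => f (j / √(n : ℝ)) := by
  simpa [inv_mul_eq_div] using summable_schwartz_lattice (inv_pos.2 (sqrt_natCast_pos (n := n))) 0 f

theorem cosetSums_schwartz (f : 𝓢(ℝ, ℂ)) :
    cosetSums (√n) n f = (dftMatrix n).mulVec (cosetSums (√n) n (𝓕⁻ f : 𝓢(ℝ, ℂ))) := by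
  have h : ⇑(𝓕⁻ f : 𝓢(ℝ, ℂ)) = 𝓕⁻ (f : ℝ → ℂ) := SchwartzMap.fourierInv_coe f
  rw [h]
  refine cosetSums_eq_mulVec f.continuous (f.isBigO_cocompact_rpow (-2)) ?_
  rw [← h]
  exact summable_schwartz_div_sqrt _

/-- No root-of-unity sums are needed: each unit vector is the coset-sum vector of a test function,
and Poisson summation places it in the range. -/
theorem dftMatrix_mulVec_surjective : Function.Surjective (dftMatrix n).mulVec := by
  intro v
  choose φ _ hφ using fun m : Fin n => exists_schwartz_cosetSums_eq_single m
  refine ⟨∑ m, v m • cosetSums (√n) n (𝓕⁻ (φ m) : 𝓢(ℝ, ℂ)), ?_⟩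
  rw [← Matrix.mulVecLin_apply, map_sum]
  simp_rw [map_smul, Matrix.mulVecLin_apply, ← cosetSums_schwartz, hφ]
  exact (pi_eq_sum_univ' v).symm

/-- The tempered distribution of the measure `∑ m, c m • δ_{m/√n} * δ_{√n ℤ}`. -/
def combDistribution (c : Fin n → ℂ) : 𝓢'(ℝ, ℂ) :=
  ∑ m : Fin n, c m • latticeDistribution (sqrt_natCast_pos (n := n)) ((m : ℕ) / √(n : ℝ))

theorem combDistribution_apply (c : Fin n → ℂ) (f : 𝓢(ℝ, ℂ)) :
    combDistribution c f = c ⬝ᵥ cosetSums (√n) n f := by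
  rw [combDistribution, FunLike.coe_sum, Finset.sum_apply]
  rfl

/-- Poisson summation is applied to `𝓕 f`, and the symmetry of the DFT matrix moves it from the
coset sums to `c`. -/
theorem fourier_combDistribution (c : Fin n → ℂ) :
    𝓕 (combDistribution c) = combDistribution ((dftMatrix n).mulVec c) := by
  ext f
  rw [TemperedDistribution.fourier_apply, combDistribution_apply, combDistribution_apply,
    cosetSums_schwartz, dotProduct_dftMatrix_mulVec, FourierTransform.fourierInv_fourier_eq]

theorem represents_combDistribution (hα : 0 < √(n : ℝ)) (c : Fin n → ℂ) :
    Represents (combDistribution c)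
      (∑ m : Fin n, c m • diracConv ((m : ℕ) / √(n : ℝ)) (latticeComb (√n) hα)) := by
  intro φ hφ
  rw [combDistribution_apply, sum_smul_diracConv_apply]
  rfl

theorem Represents.const_smul {T : 𝓢'(ℝ, ℂ)} {μ : RadonMeasure} (h : Represents T μ) (l : ℂ) :
    Represents (l • T) (l • μ) := by
  intro φ hφ
  change l • T φ = l • μ.1 _
  rw [h φ hφ]

theorem combDistribution_smul (l : ℂ) (c : Fin n → ℂ) :
    combDistribution (l • c) = l • combDistribution c := by
  ext f
  rw [combDistribution_apply, smul_dotProduct, ← combDistribution_apply]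
  rfl

theorem combDistribution_injective {c d : Fin n → ℂ}
    (h : ∀ φ : 𝓢(ℝ, ℂ), HasCompactSupport φ → combDistribution c φ = combDistribution d φ) :
    c = d := by
  funext m
  obtain ⟨φ, hφ, hφm⟩ := exists_schwartz_cosetSums_eq_single m
  simpa [combDistribution_apply, hφm] using h φ hφ

end Distribution

/-! ### Periodic eigenmeasures in the distributional sense -/

section Eigen

variable {α : ℝ} {μ : RadonMeasure}

theorem temperedDistribution_periodic {T : 𝓢'(ℝ, ℂ)} (hT : Represents T μ) (hper : IsPeriodic α μ)
    (f : 𝓢(ℝ, ℂ)) : T (SchwartzMap.compSubConstCLM ℂ α f) = T f := by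
  let S : 𝓢'(ℝ, ℂ) := PointwiseConvergenceCLM.precomp ℂ (SchwartzMap.compSubConstCLM ℂ α) T
  refine temperedDistribution_ext (S := S) (T := T) (fun φ hφ => ?_) f
  change T (SchwartzMap.compSubConstCLM ℂ α φ) = T φ
  have hφ' : HasCompactSupport (SchwartzMap.compSubConstCLM ℂ α φ) := by
    have := hφ.comp_homeomorph (Homeomorph.subRight α)
    exact this
  rw [hT φ hφ, hT _ hφ', ← hper.apply_shift]
  congr 1
  ext x
  change φ (x + α - α) = φ x
  rw [add_sub_cancel_right]

theorem exists_schwartz_eq_charSubOne_mul (α : ℝ) {φ : 𝓢(ℝ, ℂ)} (hφ : HasCompactSupport φ) :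
    ∃ ψ : 𝓢(ℝ, ℂ), HasCompactSupport ψ ∧ ∀ x, ψ x = charSubOne α x * φ x := by
  have he : ContDiff ℝ (⊤ : ℕ∞) (charSubOne α) := by
    have : (charSubOne α : ℝ → ℂ) = fun x => Complex.exp (2 * Real.pi * Complex.I *
      (α * Complex.ofRealCLM x)) - 1 := rfl
    rw [this]
    fun_prop
  have hc : HasCompactSupport (fun x => charSubOne α x * φ x) := hφ.mul_left
  exact ⟨hc.toSchwartzMap (he.mul (φ.smooth ⊤)), hc, fun x => rfl⟩

theorem fourier_charSubOne_mul {φ ψ : 𝓢(ℝ, ℂ)} (hψ : ∀ x, ψ x = charSubOne α x * φ x) :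
    𝓕 ψ = SchwartzMap.compSubConstCLM ℂ α (𝓕 φ) - 𝓕 φ := by
  ext y
  change 𝓕 (ψ : ℝ → ℂ) y = 𝓕 (φ : ℝ → ℂ) (y - α) - 𝓕 (φ : ℝ → ℂ) y
  simp only [Real.fourier_real_eq_integral_exp_smul]
  have hi : ∀ z : ℝ, Integrable fun x : ℝ =>
      Complex.exp (↑(-2 * Real.pi * x * z) * Complex.I) • φ x := fun z => by
    have hc : Continuous fun x : ℝ => Complex.exp (↑(-2 * Real.pi * x * z) * Complex.I) := by
      fun_prop
    refine φ.integrable.bdd_smul 1 hc.aestronglyMeasurable ?_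
    exact .of_forall fun x => (Complex.norm_exp_ofReal_mul_I _).le
  rw [← integral_sub (hi _) (hi _)]
  refine integral_congr_ae (.of_forall fun x => ?_)
  simp only [hψ, charSubOne_apply, smul_eq_mul]
  rw [← mul_assoc, mul_sub_one, ← Complex.exp_add, sub_mul]
  congr 3
  push_cast
  ring

/-- Multiplying `φ` by `charSubOne α` replaces `𝓕 φ` by the difference of its translate by `α` and
itself, on which the periodic `T` vanishes. -/
theorem apply_mulLeft_charSubOne_of_represents {T : 𝓢'(ℝ, ℂ)} {l : ℂ} (hl : l ≠ 0)
    (hT : Represents T μ) (hFT : Represents (𝓕 T) (l • μ)) (hper : IsPeriodic α μ)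
    (φ : 𝓢(ℝ, ℂ)) (hφ : HasCompactSupport φ) :
    μ.1 (mulLeft (charSubOne α) (ofSchwartz φ hφ)) = 0 := by
  obtain ⟨ψ, hψ, hψφ⟩ := exists_schwartz_eq_charSubOne_mul α hφ
  have h0 := hFT ψ hψ
  rw [TemperedDistribution.fourier_apply, fourier_charSubOne_mul hψφ, map_sub,
    temperedDistribution_periodic hT hper, sub_self] at h0
  have h1 : mulLeft (charSubOne α) (ofSchwartz φ hφ) = ofSchwartz ψ hψ := by
    ext x
    exact (hψφ x).symm
  have h2 : l * μ.1 (ofSchwartz ψ hψ) = 0 := h0.symm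
  rw [h1]
  exact (mul_eq_zero.1 h2).resolve_left hl

theorem hasFourierTransform_comb {n : ℕ} [NeZero n] (hα : 0 < √(n : ℝ)) {l : ℂ} {c : Fin n → ℂ}
    (hc : (dftMatrix n).mulVec c = l • c) :
    HasFourierTransform (∑ m : Fin n, c m • diracConv ((m : ℕ) / √(n : ℝ)) (latticeComb (√n) hα))
      (l • ∑ m : Fin n, c m • diracConv ((m : ℕ) / √(n : ℝ)) (latticeComb (√n) hα)) := by
  refine ⟨combDistribution c, represents_combDistribution hα c, ?_⟩
  rw [fourier_combDistribution, hc, combDistribution_smul]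
  exact (represents_combDistribution hα c).const_smul l

theorem IsEigenmeasure.exists_comb (hα : 0 < α) {l : ℂ} (hl : l ≠ 0) (hμ : IsEigenmeasure l μ)
    (hper : IsPeriodic α μ) :
    ∃ n : ℕ, 0 < n ∧ α = √(n : ℝ) ∧ ∃ c : Fin n → ℂ, c ≠ 0 ∧ (dftMatrix n).mulVec c = l • c ∧
      μ = ∑ m : Fin n, c m • diracConv ((m : ℕ) / α) (latticeComb α hα) := by
  obtain ⟨hμ0, T, hT, hFT⟩ := hμ
  obtain ⟨n, hn, rfl, c, hc0, hμc⟩ := exists_eq_sum_diracConv hα hμ0 hper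
    (apply_mulLeft_charSubOne_of_represents hl hT hFT hper)
  have : NeZero n := ⟨hn.ne'⟩
  refine ⟨n, hn, rfl, c, hc0, ?_, hμc⟩
  have hc := represents_combDistribution hα c
  rw [← hμc] at hc
  refine combDistribution_injective fun φ hφ => ?_
  have hTc : ∀ f, T f = combDistribution c f :=
    temperedDistribution_ext fun ψ hψ => (hT ψ hψ).trans (hc ψ hψ).symm
  rw [← fourier_combDistribution, TemperedDistribution.fourier_apply, ← hTc,
    ← TemperedDistribution.fourier_apply, hFT φ hφ, combDistribution_smul]
  exact ((hc.const_smul l) φ hφ).symm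

end Eigen

/-! ### Square summability of Fourier transforms over lattices -/

section Bessel

theorem isBigO_rpow_of_compactlySupported (g : C_c(ℝ, ℂ)) (b : ℝ) :
    g =O[cocompact ℝ] fun x : ℝ => |x| ^ b := by
  have h := hasCompactSupport_iff_eventuallyEq.1 g.hasCompactSupport
  rw [coclosedCompact_eq_cocompact] at h
  exact h.trans_isBigO (Asymptotics.isBigO_zero _ _)

theorem integrable_compactlySupported (g : C_c(ℝ, ℂ)) (m : Measure ℝ) [IsLocallyFiniteMeasure m] :
    Integrable g m :=
  g.continuous.integrable_of_hasCompactSupport g.hasCompactSupport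

/-- The function `x ↦ g (a * x)`, for `a ≠ 0`. -/
def dilate (a : ℝ) (ha : a ≠ 0) (g : C_c(ℝ, ℂ)) : C_c(ℝ, ℂ) :=
  g.comp (Homeomorph.mulLeft₀ a ha).toCocompactMap

/-- The values `𝓕 g j` are the Fourier coefficients of the periodisation of `g`, a continuous and
hence square-integrable function on the circle. -/
theorem summable_sq_fourier_int (g : C_c(ℝ, ℂ)) :
    Summable fun j : ℤ => ‖𝓕 (g : ℝ → ℂ) j‖ ^ 2 := by
  let f : C(ℝ, ℂ) := ⟨g, g.continuous⟩
  have h_norm : ∀ K : TopologicalSpace.Compacts ℝ, Summable fun n : ℤ =>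
      ‖(f.comp <| ContinuousMap.addRight n).restrict K‖ := fun K =>
    summable_of_isBigO (Real.summable_abs_int_rpow one_lt_two)
      ((isBigO_norm_restrict_cocompact f zero_lt_two (isBigO_rpow_of_compactlySupported g _)
        K).comp_tendsto Int.tendsto_coe_cofinite)
  let F : C(UnitAddCircle, ℂ) :=
    ⟨(f.periodic_tsum_comp_add_zsmul 1).lift, continuous_coinduced_dom.mpr (map_continuous _)⟩
  have hF := (hasSum_sq_fourierCoeff (ContinuousMap.toLp 2 AddCircle.haarAddCircle ℂ F)).summable
  refine hF.congr fun j => ?_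
  rw [fourierCoeff_toLp]
  exact congrArg (fun z => ‖z‖ ^ 2) (Real.fourierCoeff_tsum_comp_add h_norm j)

/-- Bessel's inequality: the Fourier transform of a function in `C_c(ℝ, ℂ)` is square summable over
any lattice. -/
theorem summable_sq_fourierInv_lattice {α : ℝ} (hα : 0 < α) (g : C_c(ℝ, ℂ)) :
    Summable fun j : ℤ => ‖𝓕⁻ (g : ℝ → ℂ) (j / α)‖ ^ 2 := by
  have h := ((Equiv.neg ℤ).summable_iff.2 (summable_sq_fourier_int (dilate α hα.ne' g))).mul_left
    (α ^ 2)
  refine h.congr fun j => ?_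
  have h1 : 𝓕 (dilate α hα.ne' g : ℝ → ℂ) ((Equiv.neg ℤ j : ℤ) : ℝ) =
      (α : ℂ)⁻¹ * 𝓕⁻ (g : ℝ → ℂ) (j / α) := by
    have := fourier_comp_mul_left g hα ((Equiv.neg ℤ j : ℤ) : ℝ)
    rw [Real.fourierInv_eq_fourier_neg]
    simpa [neg_div] using! this
  rw [Function.comp_apply, h1, norm_mul, norm_inv, Complex.norm_real, Real.norm_of_nonneg hα.le]
  field_simp

theorem fourierInv_conv (f g : C_c(ℝ, ℂ)) (y : ℝ) :
    𝓕⁻ (conv f g : ℝ → ℂ) y = 𝓕⁻ (f : ℝ → ℂ) y * 𝓕⁻ (g : ℝ → ℂ) y := by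
  simp only [Real.fourierInv_eq_fourier_neg]
  exact Real.fourier_mul_convolution_eq (integrable_compactlySupported f volume)
    (integrable_compactlySupported g volume) (-y)

theorem summable_fourierInv_conv {α : ℝ} (hα : 0 < α) (f g : C_c(ℝ, ℂ)) :
    Summable fun j : ℤ => 𝓕⁻ (conv f g : ℝ → ℂ) (j / α) := by
  refine Summable.of_norm_bounded ((summable_sq_fourierInv_lattice hα f).add
    (summable_sq_fourierInv_lattice hα g)) fun j => ?_
  rw [fourierInv_conv, norm_mul]
  nlinarith [sq_nonneg (‖𝓕⁻ (f : ℝ → ℂ) (j / α)‖ - ‖𝓕⁻ (g : ℝ → ℂ) (j / α)‖),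
    sq_nonneg ‖𝓕⁻ (f : ℝ → ℂ) (j / α)‖, sq_nonneg ‖𝓕⁻ (g : ℝ → ℂ) (j / α)‖]

theorem cosetSums_conv {n : ℕ} [NeZero n] (f g : C_c(ℝ, ℂ)) :
    cosetSums (√n) n (conv f g) =
      (dftMatrix n).mulVec (cosetSums (√n) n (𝓕⁻ (conv f g : ℝ → ℂ))) :=
  cosetSums_eq_mulVec (conv f g).continuous (isBigO_rpow_of_compactlySupported _ _)
    (summable_fourierInv_conv sqrt_natCast_pos f g)

end Bessel

/-! ### Polar decomposition and strict transform of lattice combs -/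

section LatticeMeasure

variable (α : ℝ) (w : ℤ → ℂ)

/-- The measure `∑ j, |w j| • δ_{j/α}`. -/
def latticeMeasure : Measure ℝ :=
  ((Measure.count : Measure ℤ).withDensity fun j => (‖w j‖₊ : ENNReal)).map fun j : ℤ => (j : ℝ) / α

/-- A measurable unimodular function with value `w j / |w j|` at `j / α`, if `w j ≠ 0`. -/
def latticePhase (x : ℝ) : ℂ :=
  if w (round (α * x)) = 0 then 1 else w (round (α * x)) / ‖w (round (α * x))‖

theorem measurable_latticePhase : Measurable (latticePhase α w) := by
  have h : Measurable fun x : ℝ => round (α * x) := by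
    simp only [round_eq]
    fun_prop
  have h' : Measurable fun j : ℤ => if w j = 0 then (1 : ℂ) else w j / ‖w j‖ := measurable_from_top
  exact h'.comp h

theorem norm_latticePhase (x : ℝ) : ‖latticePhase α w x‖ = 1 := by
  unfold latticePhase
  split_ifs with h
  · exact norm_one
  · rw [norm_div, Complex.norm_real, norm_norm, div_self (norm_ne_zero_iff.2 h)]

variable {α w}

theorem norm_smul_latticePhase (hα : 0 < α) (j : ℤ) :
    (‖w j‖ : ℂ) * latticePhase α w (j / α) = w j := by
  unfold latticePhase
  rw [mul_div_cancel₀ _ hα.ne', round_intCast]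
  split_ifs with h
  · rw [h, norm_zero, Complex.ofReal_zero, zero_mul]
  · rw [mul_div_cancel₀ _ (Complex.ofReal_ne_zero.2 (norm_ne_zero_iff.2 h))]

theorem measurableEmbedding_lattice (hα : 0 < α) : MeasurableEmbedding fun j : ℤ => (j : ℝ) / α where
  injective i j h := by
    have := (div_left_inj' hα.ne').1 h
    exact_mod_cast this
  measurable := measurable_from_top
  measurableSet_image' s _ := (s.to_countable.image _).measurableSet

theorem integrable_latticeMeasure (hα : 0 < α) {M : ℝ} (hw : ∀ j, ‖w j‖ ≤ M) {F : ℝ → ℂ}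
    (hF : Summable fun j : ℤ => F (j / α)) : Integrable F (latticeMeasure α w) := by
  rw [latticeMeasure, (measurableEmbedding_lattice hα).integrable_map_iff,
    integrable_withDensity_iff_integrable_coe_smul measurable_from_top, integrable_count_iff]
  refine Summable.of_nonneg_of_le (fun _ => norm_nonneg _) (fun j => ?_) (hF.norm.mul_left M)
  rw [norm_smul, coe_nnnorm, norm_norm]
  exact mul_le_mul_of_nonneg_right (hw j) (norm_nonneg _)

theorem integral_latticeMeasure (hα : 0 < α) {M : ℝ} (hw : ∀ j, ‖w j‖ ≤ M) {F : ℝ → ℂ}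
    (hF : Summable fun j : ℤ => F (j / α)) :
    ∫ x, F x * latticePhase α w x ∂latticeMeasure α w = ∑' j : ℤ, w j * F (j / α) := by
  have hs : Summable fun j : ℤ => w j * F (j / α) :=
    Summable.of_norm_bounded (hF.norm.mul_left M) fun j => by
      rw [norm_mul]
      exact mul_le_mul_of_nonneg_right (hw j) (norm_nonneg _)
  have hterm : ∀ j : ℤ, ‖w j‖₊ • (F (j / α) * latticePhase α w (j / α)) = w j * F (j / α) := by
    intro j
    rw [NNReal.smul_def, coe_nnnorm, Complex.real_smul, mul_left_comm, norm_smul_latticePhase hα,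
      mul_comm]
  rw [latticeMeasure, (measurableEmbedding_lattice hα).integral_map,
    integral_withDensity_eq_integral_smul measurable_from_top]
  simp_rw [hterm]
  rw [integral_countable (integrable_count_iff.2 hs.norm)]
  simp

/-- A bump equal to `1` at `x` is integrable, so the neighbourhood of `x` where it is at least `1/2`
has finite mass. -/
theorem isLocallyFiniteMeasure_latticeMeasure (hα : 0 < α) {M : ℝ} (hw : ∀ j, ‖w j‖ ≤ M) :
    IsLocallyFiniteMeasure (latticeMeasure α w) := by
  refine ⟨fun x => ?_⟩
  let g := shift (-x) (bump 1 one_pos)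
  have hi : Integrable g (latticeMeasure α w) :=
    integrable_latticeMeasure hα hw (summable_compactlySupported_lattice hα g)
  refine ⟨{y | 1 / 2 ≤ ‖g y‖}, ?_, hi.measure_norm_ge_lt_top one_half_pos⟩
  have hgx : ‖g x‖ = 1 := by
    rw [show g x = bump 1 one_pos (x + -x) from rfl, add_neg_cancel, bump_zero, norm_one]
  have : ∀ᶠ y in 𝓝 x, 1 / 2 < ‖g y‖ :=
    (g.continuous.norm.tendsto x).eventually_const_lt (by
      change 1 / 2 < ‖g x‖
      rw [hgx]
      norm_num)
  filter_upwards [this] with y hy using hy.le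

variable {n : ℕ} [NeZero n]

theorem exists_norm_periodicExt_le (c : Fin n → ℂ) : ∃ M, ∀ j, ‖periodicExt n c j‖ ≤ M :=
  ⟨∑ m, ‖c m‖, fun _ => Finset.single_le_sum (f := fun m => ‖c m‖) (fun _ _ => norm_nonneg _)
    (Finset.mem_univ _)⟩

theorem isPolarDecomposition_comb (hα : 0 < √(n : ℝ)) (c : Fin n → ℂ) :
    IsPolarDecomposition
      (∑ m : Fin n, c m • diracConv ((m : ℕ) / √(n : ℝ)) (latticeComb (√n) hα))
      (latticeMeasure (√n) (periodicExt n c)) (latticePhase (√n) (periodicExt n c)) := by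
  obtain ⟨M, hM⟩ := exists_norm_periodicExt_le c
  refine ⟨isLocallyFiniteMeasure_latticeMeasure hα hM, measurable_latticePhase _ _,
    norm_latticePhase _ _, fun g => ?_⟩
  have hg := summable_compactlySupported_lattice hα g
  rw [sum_smul_diracConv_apply, integral_latticeMeasure hα hM hg, tsum_periodicExt_mul hg]

theorem hasStrictFourierTransform_comb (hα : 0 < √(n : ℝ)) (c : Fin n → ℂ) :
    HasStrictFourierTransform
      (∑ m : Fin n, c m • diracConv ((m : ℕ) / √(n : ℝ)) (latticeComb (√n) hα))
      (∑ m : Fin n, (dftMatrix n).mulVec c m • diracConv ((m : ℕ) / √(n : ℝ))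
        (latticeComb (√n) hα)) := by
  obtain ⟨M, hM⟩ := exists_norm_periodicExt_le ((dftMatrix n).mulVec c)
  refine ⟨_, _, isPolarDecomposition_comb hα _, fun f g => ?_⟩
  have hs := summable_fourierInv_conv hα f g
  refine ⟨integrable_latticeMeasure hα hM hs, ?_⟩
  rw [integral_latticeMeasure hα hM hs, tsum_periodicExt_mul hs, sum_smul_diracConv_apply,
    cosetSums_conv, dotProduct_dftMatrix_mulVec]

end LatticeMeasure

/-! ### Periodic measures with a strict transform -/

theorem shift_conv (t : ℝ) (f g : C_c(ℝ, ℂ)) : shift t (conv f g) = conv f (shift t g) := by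
  ext x
  rw [shift_apply, conv_apply, conv_apply]
  refine integral_congr_ae (.of_forall fun s => ?_)
  simp only [shift_apply]
  congr 2
  ring

theorem fourierInv_shift (t : ℝ) (g : C_c(ℝ, ℂ)) (y : ℝ) :
    𝓕⁻ (shift t g : ℝ → ℂ) y =
      Complex.exp (↑(-2 * Real.pi * t * y) * Complex.I) * 𝓕⁻ (g : ℝ → ℂ) y :=
  fourierInv_comp_add_right g t y

theorem continuous_fourierInv_compactlySupported (g : C_c(ℝ, ℂ)) : Continuous (𝓕⁻ (g : ℝ → ℂ)) :=
  continuous_fourierInv (integrable_compactlySupported g volume)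

theorem norm_fourierInv_le (f : ℝ → ℂ) (y : ℝ) : ‖𝓕⁻ f y‖ ≤ ∫ x, ‖f x‖ := by
  rw [Real.fourierInv_eq_fourier_neg]
  exact VectorFourier.norm_fourierIntegral_le_integral_norm _ _ _ _ _

theorem exists_bump_eq_ofReal (r : ℝ) (hr : 0 < r) :
    ∃ χ : ContDiffBump (0 : ℝ), ∀ x, bump r hr x = (χ x : ℂ) :=
  ⟨⟨r / 2, r, half_pos hr, half_lt_self hr⟩, fun _ => rfl⟩

theorem norm_bump_le_one {r : ℝ} (hr : 0 < r) (x : ℝ) : ‖bump r hr x‖ ≤ 1 := by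
  obtain ⟨χ, hχ⟩ := exists_bump_eq_ofReal r hr
  rw [hχ, Complex.norm_real, Real.norm_of_nonneg χ.nonneg]
  exact χ.le_one

theorem fourierInv_bump_zero_ne_zero {r : ℝ} (hr : 0 < r) : 𝓕⁻ (bump r hr : ℝ → ℂ) 0 ≠ 0 := by
  obtain ⟨χ, hχ⟩ := exists_bump_eq_ofReal r hr
  have h : 𝓕⁻ (bump r hr : ℝ → ℂ) 0 = ((∫ x, χ x : ℝ) : ℂ) := by
    rw [Real.fourierInv_eq_fourier_neg, Real.fourier_real_eq_integral_exp_smul, ← integral_complex_ofReal]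
    refine integral_congr_ae (.of_forall fun x => ?_)
    simp [hχ]
  rw [h]
  exact Complex.ofReal_ne_zero.2 (χ.integral_pos (μ := volume)).ne'

theorem conv_bump_shift_eq_zero {r : ℝ} (hr : 0 < r) {t x : ℝ} (hx : 2 * r ≤ |x - t|) :
    conv (bump r hr) (shift (-t) (bump r hr)) x = 0 := by
  rw [conv_apply]
  refine (integral_congr_ae (.of_forall fun s => ?_)).trans (integral_zero ℝ ℂ)
  simp only [shift_apply]
  by_cases hs : r ≤ |s|
  · rw [bump_eq_zero hr hs, zero_mul]
  · rw [bump_eq_zero hr (x := x - s + -t), mul_zero]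
    have h1 : |x - t| ≤ |x - s + -t| + |s| := by
      calc |x - t| = |(x - s + -t) + s| := by ring_nf
        _ ≤ _ := abs_add_le _ _
    linarith [not_le.1 hs]

theorem conv_bump_shift_ne_zero {r : ℝ} (hr : 0 < r) (t : ℝ) :
    conv (bump r hr) (shift (-t) (bump r hr)) t ≠ 0 := by
  obtain ⟨χ, hχ⟩ := exists_bump_eq_ofReal r hr
  have h : conv (bump r hr) (shift (-t) (bump r hr)) t = ((∫ x, χ x * χ x : ℝ) : ℂ) := by
    rw [conv_apply, ← integral_complex_ofReal]
    refine integral_congr_ae (.of_forall fun s => ?_)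
    simp only [shift_apply, hχ]
    rw [show t - s + -t = -s by ring, χ.neg]
    push_cast
    rfl
  rw [h]
  refine Complex.ofReal_ne_zero.2 (ne_of_gt ?_)
  refine (χ.continuous.mul χ.continuous).integral_pos_of_hasCompactSupport_nonneg_nonzero
    χ.hasCompactSupport.mul_left (fun x => mul_self_nonneg _) (x := 0) ?_
  have h1 : χ 0 = 1 := χ.one_of_mem_closedBall (by simpa using χ.rIn_pos.le)
  simp [h1]

section StrictTransform

variable {α : ℝ} {l : ℂ} {μ : RadonMeasure} {m : Measure ℝ} {h : ℝ → ℂ}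

theorem exp_mul_charSubOne (α t y : ℝ) :
    Complex.exp (↑(-2 * Real.pi * t * y) * Complex.I) * charSubOne α y =
      Complex.exp (↑(-2 * Real.pi * (t - α) * y) * Complex.I) -
        Complex.exp (↑(-2 * Real.pi * t * y) * Complex.I) := by
  rw [charSubOne_apply, mul_sub_one, ← Complex.exp_add]
  congr 2
  push_cast
  ring

theorem IsPolarDecomposition.bdd_mul {ν : RadonMeasure} (hp : IsPolarDecomposition ν m h)
    {F : ℝ → ℂ} (hF : Integrable F m) : Integrable (fun x => F x * h x) m :=
  hF.mul_bdd (c := 1) hp.measurable.aestronglyMeasurable (.of_forall fun x => (hp.norm_eq_one x).le)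

theorem integrable_charSubOne_mul {F : ℝ → ℂ} (hF : Integrable F m) :
    Integrable (fun y => charSubOne α y * F y) m :=
  hF.bdd_mul (c := 2) (charSubOne α).continuous.aestronglyMeasurable
    (.of_forall (norm_charSubOne_le α))

/-- The Fourier coefficients of the finite measure `charSubOne α • 𝓕⁻ (f * g) • ν` vanish if `ν` is
the strict transform of an `α`-periodic measure. -/
theorem integral_exp_mul_charSubOne_eq_zero {ν : RadonMeasure} (hp : IsPolarDecomposition ν m h)
    (hst : ∀ f g : C_c(ℝ, ℂ), Integrable (𝓕⁻ (conv f g : ℝ → ℂ)) m ∧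
      μ.1 (conv f g) = ∫ y, 𝓕⁻ (conv f g : ℝ → ℂ) y * h y ∂m)
    (hper : IsPeriodic α μ) (f g : C_c(ℝ, ℂ)) (t : ℝ) :
    ∫ y, Complex.exp (↑(-2 * Real.pi * t * y) * Complex.I) *
      (charSubOne α y * (𝓕⁻ (conv f g : ℝ → ℂ) y * h y)) ∂m = 0 := by
  have h1 : ∀ s, μ.1 (shift s (conv f g)) =
      ∫ y, 𝓕⁻ (shift s (conv f g) : ℝ → ℂ) y * h y ∂m := fun s => by
    rw [shift_conv]
    exact (hst _ _).2
  have h2 : ∀ s, Integrable (fun y => 𝓕⁻ (shift s (conv f g) : ℝ → ℂ) y * h y) m := fun s => by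
    rw [shift_conv]
    exact hp.bdd_mul (hst _ _).1
  -- The translates of `f * g` by `t` and `t - α` have the same `μ`-value; on the transform side
  -- their difference carries the factor `charSubOne α`.
  have h3 : shift α (shift (t - α) (conv f g)) = shift t (conv f g) := by
    ext x
    simp only [shift_apply]
    congr 1
    ring
  have h4 := hper.apply_shift (shift (t - α) (conv f g))
  rw [h3, h1, h1, eq_comm, ← sub_eq_zero, ← integral_sub (h2 _) (h2 _)] at h4
  rw [← h4]
  refine integral_congr_ae (.of_forall fun y => ?_)
  simp only [fourierInv_shift]
  rw [← mul_assoc, exp_mul_charSubOne]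
  ring

/-- Writing `ψ` as the Fourier transform of `𝓕⁻ ψ` and exchanging integrals moves the transform onto
the finite measure `G · m`, where it is zero. -/
theorem integral_schwartz_mul_eq_zero [SigmaFinite m] {G : ℝ → ℂ} (hG : Integrable G m)
    (h0 : ∀ t : ℝ, ∫ y, Complex.exp (↑(-2 * Real.pi * t * y) * Complex.I) * G y ∂m = 0)
    (ψ : 𝓢(ℝ, ℂ)) : ∫ y, ψ y * G y ∂m = 0 := by
  have key := VectorFourier.integral_bilin_fourierIntegral_eq_flip (μ := volume) (ν := m)
    (L := innerₗ ℝ) (f := (𝓕⁻ ψ : 𝓢(ℝ, ℂ))) (g := G) (ContinuousLinearMap.mul ℂ ℂ)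
    Real.continuous_fourierChar (by simpa using! continuous_inner) (𝓕⁻ ψ : 𝓢(ℝ, ℂ)).integrable hG
  have hz : ∀ x, VectorFourier.fourierIntegral Real.fourierChar m (innerₗ ℝ).flip G x = 0 := by
    intro x
    rw [← h0 x]
    refine integral_congr_ae (.of_forall fun y => ?_)
    simp only [LinearMap.flip_apply, innerₗ_apply_apply, Circle.smul_def, Real.fourierChar_apply,
      smul_eq_mul, RCLike.inner_apply, conj_trivial]
    congr 2
    push_cast
    ring
  have hψ : ∀ y, VectorFourier.fourierIntegral Real.fourierChar volume (innerₗ ℝ)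
      (𝓕⁻ ψ : 𝓢(ℝ, ℂ)) y = ψ y := fun y => by
    have h1 : (𝓕 (𝓕⁻ ψ : 𝓢(ℝ, ℂ)) : 𝓢(ℝ, ℂ)) y = ψ y := by rw [FourierTransform.fourier_fourierInv_eq]
    rwa [SchwartzMap.fourier_coe] at h1
  simpa only [hz, hψ, ContinuousLinearMap.mul_apply', mul_zero, integral_zero] using key

/-- The vanishing is first known only with an extra factor `𝓕⁻ (b * b)`. Concentrating `b` at the
origin flattens this factor, up to normalisation, to the non-zero constant `(𝓕⁻ β 0) ^ 2`, which can
be divided out. -/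
theorem apply_mulLeft_charSubOne_of_strict {ν : RadonMeasure} (hp : IsPolarDecomposition ν m h)
    (hst : ∀ f g : C_c(ℝ, ℂ), Integrable (𝓕⁻ (conv f g : ℝ → ℂ)) m ∧
      μ.1 (conv f g) = ∫ y, 𝓕⁻ (conv f g : ℝ → ℂ) y * h y ∂m)
    (hper : IsPeriodic α μ) (φ : 𝓢(ℝ, ℂ)) (hφ : HasCompactSupport φ) :
    ν.1 (mulLeft (charSubOne α) (ofSchwartz φ hφ)) = 0 := by
  have := hp.locallyFinite
  let β := bump 1 one_pos
  let G : ℝ → ℂ := fun y => mulLeft (charSubOne α) (ofSchwartz φ hφ) y * h y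
  have hG : Integrable G m := hp.bdd_mul (integrable_compactlySupported _ m)
  have hz : ∀ j : ℕ, ∫ y, 𝓕⁻ (β : ℝ → ℂ) (y / ((j : ℝ) + 1)) ^ 2 * G y ∂m = 0 := by
    intro j
    have hj : 0 < (j : ℝ) + 1 := by positivity
    have hj0 : (((j : ℝ) + 1 : ℝ) : ℂ) ≠ 0 := Complex.ofReal_ne_zero.2 hj.ne'
    let b := dilate _ hj.ne' β
    have h1 := integral_schwartz_mul_eq_zero
      (integrable_charSubOne_mul (hp.bdd_mul (hst b b).1))
      (integral_exp_mul_charSubOne_eq_zero hp hst hper b b) φ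
    have h2 : ∀ y, 𝓕⁻ (conv b b : ℝ → ℂ) y =
        ((((j : ℝ) + 1 : ℝ) : ℂ)⁻¹) ^ 2 * 𝓕⁻ (β : ℝ → ℂ) (y / ((j : ℝ) + 1)) ^ 2 := fun y => by
      rw [fourierInv_conv, ← mul_pow, ← fourierInv_comp_mul_left _ hj, sq]
      rfl
    have h3 : ∀ y, φ y * (charSubOne α y * (𝓕⁻ (conv b b : ℝ → ℂ) y * h y)) =
        ((((j : ℝ) + 1 : ℝ) : ℂ)⁻¹) ^ 2 *
          (𝓕⁻ (β : ℝ → ℂ) (y / ((j : ℝ) + 1)) ^ 2 * G y) := fun y => by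
      simp only [h2, G, mulLeft_apply, ofSchwartz_apply]
      ring
    simp_rw [h3] at h1
    rw [integral_const_mul] at h1
    exact (mul_eq_zero.1 h1).resolve_left (pow_ne_zero _ (inv_ne_zero hj0))
  have hlim : Tendsto (fun j : ℕ => ∫ y, 𝓕⁻ (β : ℝ → ℂ) (y / ((j : ℝ) + 1)) ^ 2 * G y ∂m) atTop
      (𝓝 (∫ y, 𝓕⁻ (β : ℝ → ℂ) 0 ^ 2 * G y ∂m)) := by
    have hcont := continuous_fourierInv_compactlySupported β
    refine tendsto_integral_of_dominated_convergence
      (fun y => (∫ x, ‖β x‖) ^ 2 * ‖G y‖) (fun j => ?_) (hG.norm.const_mul _) (fun j => ?_) ?_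
    · exact ((hcont.comp (continuous_id.div_const _)).pow 2).aestronglyMeasurable.mul
        hG.aestronglyMeasurable
    · refine .of_forall fun y => ?_
      rw [norm_mul, norm_pow]
      gcongr
      exact norm_fourierInv_le _ _
    · refine .of_forall fun y => ?_
      have h1 : Tendsto (fun j : ℕ => y / ((j : ℝ) + 1)) atTop (𝓝 0) := by
        simpa [div_eq_mul_inv] using! (tendsto_one_div_add_atTop_nhds_zero_nat (𝕜 := ℝ)).const_mul y
      exact (((hcont.tendsto 0).comp h1).pow 2).mul_const _
  simp_rw [hz] at hlim
  have h0 := tendsto_nhds_unique hlim tendsto_const_nhds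
  rw [integral_const_mul] at h0
  rw [hp.apply_eq]
  exact (mul_eq_zero.1 h0).resolve_left (pow_ne_zero _ (fourierInv_bump_zero_ne_zero one_pos))

/-- The formula for the integral of a function in `C_c(ℝ, ℂ)` with respect to a lattice Dirac comb
extends to continuous integrable functions that are summable over the lattice. -/
theorem integral_eq_dotProduct_cosetSums {n : ℕ} [NeZero n] {ν : RadonMeasure} {c : Fin n → ℂ}
    (hp : IsPolarDecomposition ν m h)
    (hν : ∀ g : C_c(ℝ, ℂ), ν.1 g = c ⬝ᵥ cosetSums (√n) n g) {F : C(ℝ, ℂ)} (hF : Integrable F m)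
    (hs : Summable fun j : ℤ => F (j / √(n : ℝ))) :
    ∫ y, F y * h y ∂m = c ⬝ᵥ cosetSums (√n) n F := by
  have hα := sqrt_natCast_pos (n := n)
  let ε : ℕ → ℝ := fun j => 1 / ((j : ℝ) + 1)
  have hε0 : ∀ j, ε j ≠ 0 := fun j => by positivity
  have hε : Tendsto ε atTop (𝓝 0) := tendsto_one_div_add_atTop_nhds_zero_nat
  -- Cut-offs bounded by `1` and tending to `1` pointwise: dominated convergence applies to both the
  -- integral and the lattice sum.
  let θ : ℕ → C_c(ℝ, ℂ) := fun j => dilate (ε j) (hε0 j) (bump 1 one_pos)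
  have hθ1 : ∀ j x, ‖θ j x‖ ≤ 1 := fun j x => norm_bump_le_one one_pos _
  have hθ : ∀ x, Tendsto (fun j => θ j x) atTop (𝓝 1) := fun x => by
    have h1 : Tendsto (fun j => ε j * x) atTop (𝓝 0) := by simpa using hε.mul_const x
    have h2 := ((bump 1 one_pos).continuous.tendsto 0).comp h1
    have h3 : (bump 1 one_pos).toContinuousMap 0 = 1 := bump_zero one_pos
    rwa [h3] at h2
  have hFθ : ∀ x, Tendsto (fun j => F x * θ j x) atTop (𝓝 (F x)) := fun x => by
    simpa using (hθ x).const_mul (F x)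
  have hle : ∀ j x, ‖F x * θ j x‖ ≤ ‖F x‖ := fun j x => by
    rw [norm_mul]
    exact mul_le_of_le_one_right (norm_nonneg _) (hθ1 j x)
  obtain ⟨M, hM⟩ := exists_norm_periodicExt_le c
  have hint : Tendsto (fun j => ∫ y, mulLeft F (θ j) y * h y ∂m) atTop (𝓝 (∫ y, F y * h y ∂m)) := by
    refine tendsto_integral_of_dominated_convergence (fun y => ‖F y‖) (fun j => ?_) hF.norm
      (fun j => .of_forall fun y => ?_) (.of_forall fun y => (hFθ y).mul_const _)
    · exact (mulLeft F (θ j)).continuous.aestronglyMeasurable.mul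
        hp.measurable.aestronglyMeasurable
    · rw [norm_mul, hp.norm_eq_one, mul_one]
      exact hle j y
  have hsum : Tendsto (fun j => ∑' i : ℤ, periodicExt n c i * mulLeft F (θ j) (i / √(n : ℝ))) atTop
      (𝓝 (∑' i : ℤ, periodicExt n c i * F (i / √(n : ℝ)))) := by
    refine tendsto_tsum_of_dominated_convergence (hs.norm.mul_left M)
      (fun i => (hFθ _).const_mul _) (.of_forall fun j i => ?_)
    rw [norm_mul]
    exact mul_le_mul (hM i) (hle j _) (norm_nonneg _) ((norm_nonneg _).trans (hM i))
  rw [← tsum_periodicExt_mul hs]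
  refine tendsto_nhds_unique hint (hsum.congr fun j => ?_)
  rw [tsum_periodicExt_mul (summable_compactlySupported_lattice hα _), ← hν, hp.apply_eq]

theorem HasStrictFourierTransform.mulVec_eq {n : ℕ} [NeZero n] {ν : RadonMeasure} {c d : Fin n → ℂ}
    (hst : HasStrictFourierTransform μ ν) (hμ : ∀ g : C_c(ℝ, ℂ), μ.1 g = c ⬝ᵥ cosetSums (√n) n g)
    (hν : ∀ g : C_c(ℝ, ℂ), ν.1 g = d ⬝ᵥ cosetSums (√n) n g) : (dftMatrix n).mulVec c = d := by
  obtain ⟨m, h, hp, hst⟩ := hst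
  have hα := sqrt_natCast_pos (n := n)
  have key : ∀ f g : C_c(ℝ, ℂ), ((dftMatrix n).mulVec c - d) ⬝ᵥ
      cosetSums (√n) n (𝓕⁻ (conv f g : ℝ → ℂ)) = 0 := by
    intro f g
    have h1 := integral_eq_dotProduct_cosetSums hp hν
      (F := ⟨_, continuous_fourierInv_compactlySupported (conv f g)⟩) (hst f g).1
      (summable_fourierInv_conv hα f g)
    rw [sub_dotProduct, ← dotProduct_dftMatrix_mulVec, ← cosetSums_conv, ← hμ, (hst f g).2,
      sub_eq_zero]
    exact h1
  -- Writing the defect as `U_n e` lets Poisson summation replace the coset sums of `𝓕⁻ (f * g)` by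
  -- those of `f * g`, which can be concentrated near a single lattice point.
  obtain ⟨e, he⟩ := dftMatrix_mulVec_surjective ((dftMatrix n).mulVec c - d)
  have he0 : e = 0 := by
    funext r
    -- Convolution doubles the radius, so half the lattice spacing isolates `r/√n`.
    have hr : 0 < (√(n : ℝ))⁻¹ / 2 := half_pos (inv_pos.2 hα)
    let b := bump _ hr
    have h1 := key b (shift (-((r : ℕ) / √(n : ℝ))) b)
    rw [← he, ← dotProduct_dftMatrix_mulVec, ← cosetSums_conv, cosetSums_eq_single r fun x hx =>
      conv_bump_shift_eq_zero hr (by linarith), dotProduct_single] at h1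
    exact (mul_eq_zero.1 h1).resolve_right (conv_bump_shift_ne_zero hr _)
  rw [he0, Matrix.mulVec_zero] at he
  exact (sub_eq_zero.1 he.symm)

theorem IsStrictEigenmeasure.exists_comb (hα : 0 < α) (hl : l ≠ 0) (hμ : IsStrictEigenmeasure l μ)
    (hper : IsPeriodic α μ) :
    ∃ n : ℕ, 0 < n ∧ α = √(n : ℝ) ∧ ∃ c : Fin n → ℂ, c ≠ 0 ∧ (dftMatrix n).mulVec c = l • c ∧
      μ = ∑ m : Fin n, c m • diracConv ((m : ℕ) / α) (latticeComb α hα) := by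
  obtain ⟨hμ0, -, hst⟩ := hμ
  have hann : ∀ (φ : 𝓢(ℝ, ℂ)) (hφ : HasCompactSupport φ),
      μ.1 (mulLeft (charSubOne α) (ofSchwartz φ hφ)) = 0 := by
    obtain ⟨m, h, hp, hst⟩ := hst
    intro φ hφ
    have h0 : l * μ.1 (mulLeft (charSubOne α) (ofSchwartz φ hφ)) = 0 :=
      apply_mulLeft_charSubOne_of_strict hp hst hper φ hφ
    exact (mul_eq_zero.1 h0).resolve_left hl
  obtain ⟨n, hn, rfl, c, hc0, hμc⟩ := exists_eq_sum_diracConv hα hμ0 hper hann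
  have : NeZero n := ⟨hn.ne'⟩
  have hμg : ∀ g : C_c(ℝ, ℂ), μ.1 g = c ⬝ᵥ cosetSums (√n) n g := fun g => by
    rw [hμc, sum_smul_diracConv_apply]
  refine ⟨n, hn, rfl, c, hc0, hst.mulVec_eq hμg fun g => ?_, hμc⟩
  rw [smul_dotProduct, ← hμg]
  rfl

end StrictTransform

end Eigenmeasure

end

theorem theorem4p2 (α : ℝ) (hα : 0 < α) (l : ℂ) (hl : l ^ 4 = 1)
    (μ : Eigenmeasure.RadonMeasure) (hμ : μ ≠ 0) (hper : Eigenmeasure.IsPeriodic α μ) :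
    List.TFAE
      [Eigenmeasure.IsEigenmeasure l μ,
       Eigenmeasure.IsStrictEigenmeasure l μ,
       ∃ n : ℕ, 0 < n ∧ α = Real.sqrt n ∧
        ∃ c : Fin n → ℂ, c ≠ 0 ∧ (Eigenmeasure.dftMatrix n).mulVec c = l • c ∧
          μ = ∑ m : Fin n, c m • Eigenmeasure.diracConv ((m : ℕ) / α)
                (Eigenmeasure.latticeComb α hα)] := by
  have hl0 : l ≠ 0 := fun h => by simp [h] at hl
  tfae_have 1 → 3 := fun h => h.exists_comb hα hl0 hper
  tfae_have 2 → 3 := fun h => h.exists_comb hα hl0 hper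
  tfae_have 3 → 1 := by
    rintro ⟨n, hn, rfl, c, -, hc, hμc⟩
    have : NeZero n := ⟨hn.ne'⟩
    refine ⟨hμ, ?_⟩
    rw [hμc]
    exact Eigenmeasure.hasFourierTransform_comb hα hc
  tfae_have 3 → 2 := by
    rintro ⟨n, hn, rfl, c, -, hc, hμc⟩
    have : NeZero n := ⟨hn.ne'⟩
    have hst := Eigenmeasure.hasStrictFourierTransform_comb hα c
    simp_rw [hc, Pi.smul_apply, smul_assoc, ← Finset.smul_sum, ← hμc] at hst
    refine ⟨hμ, ⟨Eigenmeasure.combDistribution c, ?_⟩, hst⟩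
    rw [hμc]
    exact Eigenmeasure.represents_combDistribution hα c
  tfae_finish
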